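/- Let $m\ge 1$. A $\mathbb Z/m\mathbb Z$-graded Frobenius $\star$-algebra is a finite-dimensional unital associative $\mathbb C$-algebra $\mathcal A=\bigoplus_{r\in\mathbb Z/m\mathbb Z}\mathcal A_r$ with $\mathcal A_r\mathcal A_s\subseteq\mathcal A_{r+s}$, equipped with a conjugate-linear map $\star:\mathcal A\to\mathcal A$ satisfying $(a^\star)^\star=a$, $(ab)^\star=b^\star a^\star$, $(\mathcal A_r)^\star\subseteq\mathcal A_{-r}$, and with a linear functional $\lambda_0:\mathcal A_0\to\mathbb C$ satisfying $\lambda_0(ab)=\lambda_0(ba)$, such that, with $\lambda$ the extension of $\lambda_0$ to $\mathcal A$ by zero on $\mathcal A_r$, $r\ne 0$, the form $\langle a,b\rangle=\lambda(ab^\star)$ is a positive definite hermitian form on $\mathcal A$. Then $\phi:\mathcal A\to\mathcal A^*$, $\phi(a)=\lambda(-\cdot a)$, is a linear isomorphism. For linear functionals $\gamma,\delta$ on $\mathcal A_1$, extended to $\mathcal A$ by zero on the other components, put $\langle\gamma,\delta\rangle=\langle\phi^{-1}(\gamma),\phi^{-1}(\delta)\rangle$. For a left $\mathcal A_0$-module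 $M$, the induced module is the quotient of the graded $\mathcal A$-module $\mathcal A\otimes_{\mathcal A_0}M$ by its largest graded submodule whose component of degree $0$ is zero, and $M^{r}$ denotes its component of degree $r$. Let $\mathrm{Sim}(\mathcal A_0)^{\mathbb Z/m\mathbb Z}$ be the set of isomorphism classes of simple left $\mathcal A_0$-modules $M$ with $M^{r}\cong M$ as $\mathcal A_0$-modules for all $r\in\mathbb Z/m\mathbb Z$. A twisted class functional on $\mathcal A_1$ is a linear functional $\gamma:\mathcal A_1\to\mathbb C$ with $\gamma(ax)=\gamma(xa)$ for all $a\in\mathcal A_0$, $x\in\mathcal A_1$. Theorem. Let $\mathcal A$ be a $\mathbb Z/m\mathbb Z$-graded Frobenius $\star$-algebra. (0) Every $M\in\mathrm{Sim}(\mathcal A_0)^{\mathbb Z/m\mathbb Z}$ extends to an $\mathcal A$-module. For an extension $\tilde M$ of $M$ with character $\chi_{\tilde M}:\mathcal A\to\mathbb C$, let $\tilde\chi_M=\chi_{\tilde M}|_{\mathcal A_1}$ be the twisted character. (1) Let $M\in\mathrm{Sim}(\mathcal A_0)^{\mathbb Z/m\mathbb Z}$, with any extension $\tilde M$. Then there is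 a central idempotent $e_{\tilde M}$ of $\mathcal A$ such that $\mathcal A e_{\tilde M}$ is the sum of all left ideals of $\mathcal A$ isomorphic to $\tilde M$, there is a scalar $c_M\in\mathbb C$ with $\phi^{-1}(\chi_{\tilde M})=c_M e_{\tilde M}$ (both are unique), and $$\langle\tilde\chi_M,\tilde\chi_M\rangle=\frac{|c_M|^2\,\langle e_{\tilde M},e_{\tilde M}\rangle}{m}.$$ (2) If $M,N\in\mathrm{Sim}(\mathcal A_0)^{\mathbb Z/m\mathbb Z}$ are not isomorphic, then $\langle\tilde\chi_M,\tilde\chi_N\rangle=0$ for all choices of the extensions $\tilde M,\tilde N$. (3) If one extension is chosen for a representative of each class in $\mathrm{Sim}(\mathcal A_0)^{\mathbb Z/m\mathbb Z}$, then the twisted characters $\{\tilde\chi_M: M\in\mathrm{Sim}(\mathcal A_0)^{\mathbb Z/m\mathbb Z}\}$ form an orthogonal basis of the space of twisted class functionals on $\mathcal A_1$. -/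

import Mathlib

open scoped TensorProduct

universe u v w

namespace TwistedFrobenius

noncomputable section

/-! ### Graded Frobenius star-algebras -/

section Algebra

variable {m : ℕ} {A : Type u} [Ring A] [Algebra ℂ A]

/-- The projection of `A = ⨁ 𝒜 r` onto its component of degree `r`. -/
def gradeProj (𝒜 : ZMod m → Submodule ℂ A) [GradedAlgebra 𝒜] (r : ZMod m) : A →ₗ[ℂ] 𝒜 r :=
  DirectSum.component ℂ (ZMod m) (fun i => 𝒜 i) r ∘ₗ
    (DirectSum.decomposeLinearEquiv 𝒜).toLinearMap

/-- A functional on `𝒜 r`, extended to `A` by zero on the other components. -/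
def extendByZero (𝒜 : ZMod m → Submodule ℂ A) [GradedAlgebra 𝒜] (r : ZMod m)
    (γ : Module.Dual ℂ (𝒜 r)) : Module.Dual ℂ A :=
  γ ∘ₗ gradeProj 𝒜 r

/-- The data and axioms which make the `ℤ/mℤ`-graded algebra `A`, with its conjugate linear
anti-involution `star`, a `ℤ/mℤ`-graded Frobenius `⋆`-algebra: a class functional `lam0` on the
subalgebra `𝒜 0` such that, with `lam` its extension by zero, `⟨a, b⟩ = lam (a * star b)` is a
positive definite hermitian form on `A`; and `star` maps degree `r` to degree `-r`. -/
structure FrobeniusStar [StarRing A] [StarModule ℂ A]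
    (𝒜 : ZMod m → Submodule ℂ A) [GradedAlgebra 𝒜] where
  lam0 : Module.Dual ℂ (𝒜 0)
  lam0_mul_comm : ∀ a b : 𝒜 0, lam0 (a * b) = lam0 (b * a)
  star_mem : ∀ (r : ZMod m) (a : A), a ∈ 𝒜 r → star a ∈ 𝒜 (-r)
  hermitian : ∀ a b : A, extendByZero 𝒜 0 lam0 (a * star b)
    = (starRingEnd ℂ) (extendByZero 𝒜 0 lam0 (b * star a))
  pos : ∀ a : A, a ≠ 0 → 0 < (extendByZero 𝒜 0 lam0 (a * star a)).re

namespace FrobeniusStar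

variable [StarRing A] [StarModule ℂ A] {𝒜 : ZMod m → Submodule ℂ A} [GradedAlgebra 𝒜]
  (F : FrobeniusStar 𝒜)

/-- The functional `λ` on `A`. -/
def lam : Module.Dual ℂ A := extendByZero 𝒜 0 F.lam0

/-- The positive definite hermitian form `⟨a, b⟩ = λ(a b⋆)` on `A`. -/
def form (a b : A) : ℂ := F.lam (a * star b)

/-- The linear map `φ : A → A*`, `φ(a) = λ(- · a)`. -/
def phiHom : A →ₗ[ℂ] Module.Dual ℂ A :=
  LinearMap.mk₂ ℂ (fun a x => F.lam (x * a))
    (fun a b x => by simp [mul_add]) (fun c a x => by simp)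
    (fun a x y => by simp [add_mul]) (fun c a x => by simp)

theorem phiHom_injective : Function.Injective F.phiHom := by
  rw [← LinearMap.ker_eq_bot, LinearMap.ker_eq_bot']
  intro a ha
  by_contra hne
  have h1 : F.lam (star a * a) = 0 := by
    have := LinearMap.congr_fun ha (star a)
    simpa [phiHom] using this
  have h2 := F.pos (star a) (by simpa using hne)
  rw [star_star] at h2
  have h3 : extendByZero 𝒜 0 F.lam0 (star a * a) = 0 := h1
  rw [h3] at h2
  simp at h2

/-- The isomorphism `φ : A ≅ A*`, `φ(a) = λ(- · a)`. -/
def phi [FiniteDimensional ℂ A] : A ≃ₗ[ℂ] Module.Dual ℂ A :=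
  LinearEquiv.ofBijective F.phiHom ⟨F.phiHom_injective,
    (LinearMap.injective_iff_surjective_of_finrank_eq_finrank
      (Subspace.dual_finrank_eq (K := ℂ) (V := A)).symm).1 F.phiHom_injective⟩

/-- The hermitian form on functionals on `𝒜 r`: extend by zero to `A`, transport by `φ`. -/
def dualForm [FiniteDimensional ℂ A] (r : ZMod m) (γ δ : Module.Dual ℂ (𝒜 r)) : ℂ :=
  F.form (F.phi.symm (extendByZero 𝒜 r γ)) (F.phi.symm (extendByZero 𝒜 r δ))

end FrobeniusStar

theorem zero_mul_mem {𝒜 : ZMod m → Submodule ℂ A} [GradedAlgebra 𝒜] {r : ZMod m} (a : 𝒜 0)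
    {x : A} (hx : x ∈ 𝒜 r) : (a : A) * x ∈ 𝒜 r := by
  simpa using SetLike.mul_mem_graded a.2 hx

theorem mul_zero_mem {𝒜 : ZMod m → Submodule ℂ A} [GradedAlgebra 𝒜] {r : ZMod m} (a : 𝒜 0)
    {x : A} (hx : x ∈ 𝒜 r) : x * (a : A) ∈ 𝒜 r := by
  simpa using SetLike.mul_mem_graded hx a.2

/-- The space of twisted class functionals on the `𝒜 0`-bimodule `𝒜 r`: the functionals `γ` with
`γ(a x) = γ(x a)` for all `a ∈ 𝒜 0` and `x ∈ 𝒜 r`. -/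
def twistedClassFunctionals (𝒜 : ZMod m → Submodule ℂ A) [GradedAlgebra 𝒜] (r : ZMod m) :
    Submodule ℂ (Module.Dual ℂ (𝒜 r)) where
  carrier := {γ | ∀ (a : 𝒜 0) (x : 𝒜 r),
    γ ⟨(a : A) * x, zero_mul_mem a x.2⟩ = γ ⟨(x : A) * a, mul_zero_mem a x.2⟩}
  add_mem' := by
    intro γ δ hγ hδ a x
    simp only [LinearMap.add_apply, hγ a x, hδ a x]
  zero_mem' := by intro a x; rfl
  smul_mem' := by
    intro c γ hγ a x
    simp only [LinearMap.smul_apply, hγ a x]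

end Algebra

/-! ### Induction of `𝒜 0`-modules and the partial action of `ℤ/mℤ` -/

section Induction

variable {m : ℕ} {A : Type u} [Ring A] [Algebra ℂ A]
  (𝒜 : ZMod m → Submodule ℂ A) [GradedAlgebra 𝒜]
  (M : Type v) [AddCommGroup M] [Module ℂ M] [Module (𝒜 0) M]

/-- The relations `ab ⊗ x = a ⊗ bx`, for `b ∈ 𝒜 0`, in `A ⊗_ℂ M`. -/
def balancedRel : Submodule A (A ⊗[ℂ] M) :=
  Submodule.span A {t | ∃ (a : A) (b : 𝒜 0) (x : M),
    t = (a * (b : A)) ⊗ₜ[ℂ] x - a ⊗ₜ[ℂ] (b • x)}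

/-- The left `A`-module `A ⊗_{𝒜 0} M`. -/
abbrev TensorInd : Type (max u v) := (A ⊗[ℂ] M) ⧸ balancedRel 𝒜 M

/-- The component `𝒜 r ⊗_{𝒜 0} M` of degree `r` of `A ⊗_{𝒜 0} M`. -/
def tensorGrade (r : ZMod m) : Submodule ℂ (TensorInd 𝒜 M) :=
  Submodule.span ℂ {t | ∃ a ∈ 𝒜 r, ∃ x : M,
    t = (balancedRel 𝒜 M).mkQ (a ⊗ₜ[ℂ] x)}

/-- `U` is a graded submodule of `A ⊗_{𝒜 0} M` whose component of degree zero vanishes. -/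
def IsNullGraded (U : Submodule A (TensorInd 𝒜 M)) : Prop :=
  U.restrictScalars ℂ = ⨆ r : ZMod m, U.restrictScalars ℂ ⊓ tensorGrade 𝒜 M r ∧
    U.restrictScalars ℂ ⊓ tensorGrade 𝒜 M 0 = ⊥

/-- The null socle of `A ⊗_{𝒜 0} M`, the largest null graded submodule. -/
def nullSocle : Submodule A (TensorInd 𝒜 M) := sSup {U | IsNullGraded 𝒜 M U}

/-- The induced module, the quotient of `A ⊗_{𝒜 0} M` by its null socle. -/
abbrev Induced : Type (max u v) := TensorInd 𝒜 M ⧸ nullSocle 𝒜 M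

/-- The partial action of `ℤ/mℤ`: the conjugate `M^r` of the `𝒜 0`-module `M` is the component of
degree `r` of the induced module. -/
def conjugate (r : ZMod m) : Submodule ℂ (Induced 𝒜 M) :=
  (tensorGrade 𝒜 M r).map ((nullSocle 𝒜 M).mkQ.restrictScalars ℂ)

variable {𝒜 M} in
theorem smul_mem_tensorGrade {r : ZMod m} (a : 𝒜 0) {t : TensorInd 𝒜 M}
    (ht : t ∈ tensorGrade 𝒜 M r) : (a : A) • t ∈ tensorGrade 𝒜 M r := by
  induction ht using Submodule.span_induction with
  | mem t ht =>
    obtain ⟨b, hb, x, rfl⟩ := ht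
    exact Submodule.subset_span ⟨(a : A) * b, zero_mul_mem a hb, x, rfl⟩
  | zero => rw [smul_zero]; exact zero_mem _
  | add s t _ _ hs ht => rw [smul_add]; exact add_mem hs ht
  | smul c t _ ht => rw [smul_comm]; exact Submodule.smul_mem _ c ht

variable {𝒜 M} in
theorem smul_mem_conjugate {r : ZMod m} (a : 𝒜 0) {t : Induced 𝒜 M}
    (ht : t ∈ conjugate 𝒜 M r) : (a : A) • t ∈ conjugate 𝒜 M r := by
  obtain ⟨s, hs, rfl⟩ := ht
  exact ⟨(a : A) • s, smul_mem_tensorGrade a hs, rfl⟩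

/-- `M` is `ℤ/mℤ`-invariant: `M^r` and `M` are isomorphic `𝒜 0`-modules for every `r`. -/
def IsInvariant : Prop :=
  ∀ r : ZMod m, ∃ f : conjugate 𝒜 M r ≃ₗ[ℂ] M,
    ∀ (a : 𝒜 0) (t : conjugate 𝒜 M r),
      f ⟨(a : A) • (t : Induced 𝒜 M), smul_mem_conjugate a t.2⟩ = a • f t

end Induction

/-! ### Extensions to `A` and twisted characters -/

section Extension

variable {m : ℕ} {A : Type u} [Ring A] [Algebra ℂ A]
  (𝒜 : ZMod m → Submodule ℂ A) [GradedAlgebra 𝒜]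
  (M : Type v) [AddCommGroup M] [Module ℂ M] [Module (𝒜 0) M]

/-- An extension of the `𝒜 0`-module `M` to an `A`-module: an action of `A` on the space `M` which
restricts to the given action of `𝒜 0`. -/
structure Extension where
  action : A →ₐ[ℂ] Module.End ℂ M
  action_zero : ∀ (a : 𝒜 0) (x : M), action (a : A) x = a • x

namespace Extension

variable {𝒜 M} (E : Extension 𝒜 M)

/-- The space `M`, regarded as an `A`-module through the extension `E`. -/
def Space (_E : Extension 𝒜 M) : Type v := M

instance : AddCommGroup E.Space := inferInstanceAs (AddCommGroup M)

instance : Module A E.Space :=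
  letI : Module (Module.End ℂ M) E.Space := inferInstanceAs (Module (Module.End ℂ M) M)
  Module.compHom E.Space E.action.toRingHom

/-- The character of the extension, a functional on `A`. -/
def character : Module.Dual ℂ A := LinearMap.trace ℂ M ∘ₗ E.action.toLinearMap

/-- The twisted character, the restriction to `𝒜 1` of the character of the extension. -/
def twistedCharacter : Module.Dual ℂ (𝒜 1) := E.character ∘ₗ (𝒜 1).subtype

/-- `e` is the central idempotent of `A` that belongs to the `A`-module `E.Space`: it generates the
sum of all left ideals of `A` isomorphic to this module. -/
def IsCentralIdempotent (e : A) : Prop :=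
  e ∈ Subring.center A ∧ e * e = e ∧ Ideal.span {e} = isotypicComponent A A E.Space

end Extension

end Extension

end

end TwistedFrobenius

/-!
Positivity of the form makes `𝒜 0` and `A` semisimple. If the simple `𝒜 0`-module `M`, with block
idempotent `f`, is invariant, then an isomorphism `M¹ ≅ M` yields a homomorphism of
`𝒜 0`-bimodules `𝒜 1 → End M` whose image contains `1`, hence an element `v` of `𝒜 1` which
commutes with `𝒜 0` and lies in the block `f`. By Schur's lemma `v⋆ v` and `v ^ m` are multiples
of `f`, and positivity of the form allows `v` to be rescaled to a unitary of the block with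
`v ^ m = f`. Its powers form a representation `w` of `ℤ/mℤ` with `w r ∈ 𝒜 r` and `w 0 = f`.

The functional `a ↦ λ(a ∑ w r)` is, up to a scalar, the character of an extension of `M`, so that
`φ⁻¹` maps characters to multiples of the central idempotents `m⁻¹ ∑ w r`, and twisted characters
to multiples of `w (-1)`. Orthogonality and the norm formula follow from the relations between the
`w r`. For a twisted class functional `γ` the element `z = φ⁻¹(γ) ∈ 𝒜 (-1)` commutes with `𝒜 0`.
It is the sum of its parts `z f` over the blocks `f` of `𝒜 0`. If `z f ≠ 0`, then `v = (z f)⋆`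
yields a representation `w` as above, so that the block `f` belongs to an invariant module and
`z f` is a multiple of `w (-1)` by Schur's lemma.
-/

namespace TwistedFrobenius

noncomputable section

/-! ### Semisimplicity and block idempotents -/

section ProperInvolution

variable {R : Type*} [Ring R] {σ : R → R}

theorem map_pow_eq_self_of_antiautomorphism (hmul : ∀ a b, σ (a * b) = σ b * σ a) (hone : σ 1 = 1)
    {y : R} (hy : σ y = y) (k : ℕ) : σ (y ^ k) = y ^ k := by
  induction k with
  | zero => rw [pow_zero, hone]
  | succ k ih => rw [pow_succ, hmul, ih, hy, ← pow_succ', pow_succ]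

theorem eq_zero_of_pow_eq_zero_of_proper (hmul : ∀ a b, σ (a * b) = σ b * σ a) (hone : σ 1 = 1)
    (hproper : ∀ a, σ a * a = 0 → a = 0) {y : R} (hy : σ y = y) {n : ℕ} (hn : y ^ n = 0) :
    y = 0 := by
  have hdouble : ∀ k : ℕ, y ^ 2 ^ k = 0 → y = 0 := by
    intro k
    induction k with
    | zero => simp
    | succ k ih =>
      intro h
      refine ih (hproper _ ?_)
      rw [map_pow_eq_self_of_antiautomorphism hmul hone hy, ← sq, ← pow_mul, ← pow_succ, h]
  exact hdouble n (pow_eq_zero_of_le Nat.lt_two_pow_self.le hn)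

theorem isSemisimpleRing_of_proper_involution [IsArtinianRing R]
    (hmul : ∀ a b, σ (a * b) = σ b * σ a) (hinv : ∀ a, σ (σ a) = a)
    (hproper : ∀ a, σ a * a = 0 → a = 0) : IsSemisimpleRing R := by
  have hone : σ 1 = 1 := by simpa [hinv] using (hmul (σ 1) 1).symm
  rw [IsArtinianRing.isSemisimpleRing_iff_jacobson, eq_bot_iff]
  intro x hx
  obtain ⟨n, hn⟩ := IsSemiprimaryRing.isNilpotent (R := R)
  have hpow : (σ x * x) ^ n = 0 := by
    simpa [hn] using Ideal.pow_mem_pow (Ideal.mul_mem_left _ (σ x) hx) n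
  exact hproper x (eq_zero_of_pow_eq_zero_of_proper hmul hone hproper (by rw [hmul, hinv]) hpow)

end ProperInvolution

section Block

variable {R : Type*} [Ring R] {M : Type*} [AddCommGroup M] [Module R M]
  {N : Type*} [AddCommGroup N] [Module R N]

theorem map_eq_zero_of_mem_isotypicComponent {B : Type*} [AddCommMonoid B] (ψ : N →+ B)
    (h : ∀ (g : M →ₗ[R] N) (x : M), ψ (g x) = 0) {y : N} (hy : y ∈ isotypicComponent R N M) :
    ψ y = 0 := by
  rw [isotypicComponent, sSup_eq_iSup'] at hy
  induction hy using Submodule.iSup_induction' with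
  | mem m b hb =>
    obtain ⟨e⟩ := m.2
    simpa using h (m.1.subtype ∘ₗ e.symm.toLinearMap) (e ⟨b, hb⟩)
  | zero => exact map_zero ψ
  | add b c _ _ hb hc => rw [map_add, hb, hc, add_zero]

theorem smul_eq_zero_of_mem_isotypicComponent {k : R} (hk : ∀ x : M, k • x = 0) {y : N}
    (hy : y ∈ isotypicComponent R N M) : k • y = 0 :=
  map_eq_zero_of_mem_isotypicComponent (DistribSMul.toAddMonoidHom N k)
    (fun g x => by simp [← map_smul, hk]) hy

theorem exists_central_mem_of_isCompl {I J : Ideal R} [I.IsTwoSided] [J.IsTwoSided]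
    (h : IsCompl I J) : ∃ f ∈ I, (∀ x, Commute f x) ∧ ∀ x ∈ I, f * x = x := by
  have hone : (1 : R) ∈ I ⊔ J := h.sup_eq_top ▸ Submodule.mem_top
  obtain ⟨f, hf, g, hg, hfg⟩ := Submodule.mem_sup.1 hone
  have hzero : ∀ x, x ∈ I → x ∈ J → x = 0 := Submodule.disjoint_def.1 h.disjoint
  have hleft : ∀ x ∈ I, f * x = x := fun x hx => by
    have : g * x = 0 := hzero _ (I.mul_mem_left _ hx) (J.mul_mem_right _ hg)
    rw [← add_zero (f * x), ← this, ← add_mul, hfg, one_mul]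
  have hright : ∀ x ∈ I, x * f = x := fun x hx => by
    have : x * g = 0 := hzero _ (I.mul_mem_right _ hx) (J.mul_mem_left _ hg)
    rw [← add_zero (x * f), ← this, ← mul_add, hfg, mul_one]
  refine ⟨f, hf, fun x => ?_, hleft⟩
  calc f * x = f * x * f := (hright _ (I.mul_mem_right _ hf)).symm
    _ = x * f := by rw [mul_assoc, hleft _ (I.mul_mem_left _ hf)]

variable (M) in
/-- The central idempotent `f` of `R` belonging to the module `M`: it acts as the identity on `M`
and lies in the sum of all left ideals isomorphic to `M`. That `f` is idempotent follows. -/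
structure IsBlockIdempotent (f : R) : Prop where
  commute : ∀ x, Commute f x
  mem : f ∈ isotypicComponent R R M
  smul_eq : ∀ x : M, f • x = x

namespace IsBlockIdempotent

variable {f g : R}

theorem mul_eq_self_of_mem (hf : IsBlockIdempotent M f) {y : R}
    (hy : y ∈ isotypicComponent R R M) : f * y = y := by
  have := smul_eq_zero_of_mem_isotypicComponent (k := f - 1) (M := M)
    (fun x => by rw [sub_smul, hf.smul_eq, one_smul, sub_self]) hy
  rwa [smul_eq_mul, sub_mul, one_mul, sub_eq_zero] at this

theorem mul_self (hf : IsBlockIdempotent M f) : f * f = f := hf.mul_eq_self_of_mem hf.mem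

theorem span_eq (hf : IsBlockIdempotent M f) : Ideal.span {f} = isotypicComponent R R M := by
  refine le_antisymm ((Ideal.span_singleton_le_iff_mem _).2 hf.mem) fun y hy => ?_
  rw [← hf.mul_eq_self_of_mem hy, (hf.commute y).eq]
  exact Ideal.mul_mem_left _ y (Ideal.mem_span_singleton_self f)

theorem ne_zero [Nontrivial M] (hf : IsBlockIdempotent M f) : f ≠ 0 := by
  rintro rfl
  obtain ⟨x, hx⟩ := exists_ne (0 : M)
  exact hx (by rw [← hf.smul_eq x, zero_smul])

theorem mul_eq_zero_of_smul (hf : IsBlockIdempotent M f) {k : R} (hk : ∀ x : M, k • x = 0) :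
    k * f = 0 :=
  smul_eq_zero_of_mem_isotypicComponent hk hf.mem

theorem mul_eq_mul_of_smul (hf : IsBlockIdempotent M f) {a b : R}
    (h : ∀ x : M, a • x = b • x) : a * f = b * f := by
  rw [← sub_eq_zero, ← sub_mul]
  exact hf.mul_eq_zero_of_smul fun x => by rw [sub_smul, h, sub_self]

theorem congr (hf : IsBlockIdempotent M f) (e : M ≃ₗ[R] N) : IsBlockIdempotent N f where
  commute := hf.commute
  mem := e.isotypicComponent_eq (M := R) ▸ hf.mem
  smul_eq y := e.symm.injective (by rw [map_smul, hf.smul_eq])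

theorem unique (hf : IsBlockIdempotent M f) (hg : IsBlockIdempotent M g) : f = g :=
  calc f = g * f := (hg.mul_eq_self_of_mem hf.mem).symm
    _ = f * g := hg.commute f
    _ = g := hf.mul_eq_self_of_mem hg.mem

variable [IsSimpleModule R M] [IsSimpleModule R N]

theorem smul_eq_zero (hf : IsBlockIdempotent M f) (h : ¬ Nonempty (M ≃ₗ[R] N)) (y : N) :
    f • y = 0 := by
  let t : R →ₗ[R] N := LinearMap.toSpanSingleton R N y
  refine map_eq_zero_of_mem_isotypicComponent t.toAddMonoidHom (fun g x => ?_) hf.mem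
  rcases (t ∘ₗ g).bijective_or_eq_zero with hbij | hzero
  · exact (h ⟨LinearEquiv.ofBijective _ hbij⟩).elim
  · exact LinearMap.congr_fun hzero x

theorem mul_eq_zero (hf : IsBlockIdempotent M f) (hg : IsBlockIdempotent N g)
    (h : ¬ Nonempty (M ≃ₗ[R] N)) : f * g = 0 :=
  hg.mul_eq_zero_of_smul (hf.smul_eq_zero h)

end IsBlockIdempotent

variable [IsSemisimpleRing R]

variable (R M) in
theorem exists_isBlockIdempotent [IsSimpleModule R M] : ∃ f : R, IsBlockIdempotent M f := by
  obtain ⟨S, ⟨e⟩⟩ := IsSemisimpleRing.exists_linearEquiv_ideal_of_isSimpleModule R M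
  have : IsSimpleModule R S := IsSimpleModule.congr e.symm
  set I : Ideal R := isotypicComponent R R S
  set J : Ideal R := sSup (isotypicComponents R R \ {I})
  have hI : I ∈ isotypicComponents R R := ⟨S, inferInstance, rfl⟩
  have hcompl : IsCompl I J := by
    refine ⟨sSupIndep_isotypicComponents R R hI, codisjoint_iff.2 ?_⟩
    rw [← sSup_insert, Set.insert_sdiff_self_of_mem hI, sSup_isotypicComponents]
  have : I.IsTwoSided := isFullyInvariant_iff_isTwoSided.1 (.isotypicComponent R R S)
  have : J.IsTwoSided := isFullyInvariant_iff_isTwoSided.1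
    (isFullyInvariant_iff_sSup_isotypicComponents.2 ⟨_, Set.sdiff_subset, rfl⟩)
  obtain ⟨f, hmem, hcomm, hone⟩ := exists_central_mem_of_isCompl hcompl
  have hf : IsBlockIdempotent S f :=
    ⟨hcomm, hmem, fun x => Subtype.ext (hone x (S.le_isotypicComponent x.2))⟩
  exact ⟨f, hf.congr e.symm⟩

variable (R) in
theorem one_mem_closure_blockIdempotents :
    (1 : R) ∈ AddSubmonoid.closure
      {f | ∃ S : Ideal R, IsSimpleModule R S ∧ IsBlockIdempotent S f} := by
  have hblock : ∀ c : isotypicComponents R R, ∃ (S : Ideal R) (f : R), IsSimpleModule R S ∧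
      c = isotypicComponent R R S ∧ IsBlockIdempotent S f := by
    rintro ⟨_, S, hS, rfl⟩
    obtain ⟨f, hf⟩ := exists_isBlockIdempotent R S
    exact ⟨S, f, hS, rfl, hf⟩
  choose S f hsimple hS hf using hblock
  have := Fintype.ofFinite (isotypicComponents R R)
  have hmul : ∀ x, (∑ c, f c) * x = x := by
    intro x
    have hx : x ∈ ⨆ c : isotypicComponents R R, (c : Ideal R) := by
      rw [← sSup_eq_iSup', sSup_isotypicComponents]; trivial
    induction hx using Submodule.iSup_induction' with
    | mem c x hx =>
      rw [Finset.sum_mul, Finset.sum_eq_single_of_mem c (Finset.mem_univ c) fun d _ hdc => ?_]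
      · exact (hf c).mul_eq_self_of_mem (hS c ▸ hx)
      · refine smul_eq_zero_of_mem_isotypicComponent ((hf d).smul_eq_zero (N := S c) ?_) (hS c ▸ hx)
        rintro ⟨e⟩
        exact hdc (Subtype.ext (by rw [hS, hS, e.isotypicComponent_eq]))
    | zero => exact mul_zero _
    | add x y _ _ hx hy => rw [mul_add, hx, hy]
  rw [← hmul 1, mul_one]
  exact sum_mem fun c _ => AddSubmonoid.subset_closure ⟨S c, hsimple c, hf c⟩

end Block

/-! ### Simple modules over an algebraically closed field -/

section EndTrace

variable {k V : Type*} [Field k] [AddCommGroup V] [Module k V] [FiniteDimensional k V]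

theorem sum_smulRight_finBasis (X : Module.End k V) :
    ∑ i, ((Module.finBasis k V).coord i).smulRight (X (Module.finBasis k V i)) = X := by
  ext x
  conv_rhs => rw [← (Module.finBasis k V).sum_repr x]
  simp only [map_sum, map_smul, LinearMap.sum_apply, LinearMap.smulRight_apply,
    Module.Basis.coord_apply]

theorem exists_eq_mul_trace (τ : Module.Dual k (Module.End k V))
    (hτ : ∀ X Y, τ (X * Y) = τ (Y * X)) : ∃ κ : k, ∀ X, τ X = κ * LinearMap.trace k V X := by
  rcases subsingleton_or_nontrivial V with h | h
  · exact ⟨0, fun X => by rw [Subsingleton.elim X 0, map_zero, map_zero, mul_zero]⟩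
  obtain ⟨v, hv⟩ := exists_ne (0 : V)
  obtain ⟨ψ, hψ⟩ := Module.Projective.exists_dual_eq_one k hv
  obtain ⟨κ, hκ⟩ : ∃ κ : k, ∀ (θ : Module.Dual k V) (x : V), τ (θ.smulRight x) = κ * θ x := by
    refine ⟨τ (ψ.smulRight v), fun θ x => ?_⟩
    have hleft : (θ.smulRight x : Module.End k V) = ψ.smulRight x * θ.smulRight v := by
      ext y
      simp [hψ]
    have hright : (θ.smulRight v : Module.End k V) * ψ.smulRight x = θ x • ψ.smulRight v := by
      ext y
      simp [smul_smul, mul_comm]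
    rw [hleft, hτ, hright, map_smul, smul_eq_mul, mul_comm]
  refine ⟨κ, fun X => ?_⟩
  rw [← sum_smulRight_finBasis X]
  simp only [map_sum, hκ, LinearMap.trace_smulRight, Finset.mul_sum]

theorem one_mem_of_isTwoSided_of_ne_bot {I : Ideal (Module.End k V)} [I.IsTwoSided] (hI : I ≠ ⊥) :
    1 ∈ I := by
  obtain ⟨X, hX, hX0⟩ := Submodule.exists_mem_ne_zero_of_ne_bot hI
  obtain ⟨y, hy⟩ : ∃ y, X y ≠ 0 := by
    by_contra! h
    exact hX0 (LinearMap.ext h)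
  obtain ⟨ψ, hψ⟩ := Module.Projective.exists_dual_eq_one k hy
  rw [← sum_smulRight_finBasis (1 : Module.End k V)]
  refine sum_mem fun i _ => ?_
  have hfactor : ((Module.finBasis k V).coord i).smulRight (Module.finBasis k V i)
      = ψ.smulRight (Module.finBasis k V i) * X * ((Module.finBasis k V).coord i).smulRight y := by
    ext x
    simp [hψ]
  rw [Module.End.one_apply, hfactor]
  exact I.mul_mem_right _ (I.mul_mem_left _ hX)

end EndTrace

section Burnside

variable {k R M : Type*} [Field k] [IsAlgClosed k] [Ring R] [Algebra k R]
  [AddCommGroup M] [Module k M] [Module R M] [IsScalarTower k R M]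
  [IsSimpleModule R M] [FiniteDimensional k M]

variable (k R M) in
theorem lsmul_surjective : Function.Surjective (Algebra.lsmul k k M : R →ₐ[k] Module.End k M) := by
  intro X
  let X' : Module.End (Module.End R M) M :=
    { X with
      map_smul' := fun g x => by
        obtain ⟨c, rfl⟩ := (IsSimpleModule.algebraMap_end_bijective_of_isAlgClosed k).2 g
        exact X.map_smul c x }
  classical
  let b := Module.finBasis k M
  obtain ⟨r, hr⟩ := jacobson_density (R := R) X' (Finset.univ.image b)
  exact ⟨r, b.ext fun i => (hr (b i) (Finset.mem_image_of_mem b (Finset.mem_univ i))).symm⟩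

variable (k) in
theorem IsBlockIdempotent.exists_mul_eq_smul {f b : R} (hf : IsBlockIdempotent M f)
    (hb : ∀ a, Commute a b) : ∃ c : k, b * f = c • f := by
  let T : Module.End R M :=
    { DistribSMul.toAddMonoidHom M b with
      map_smul' := fun a x => by
        change b • a • x = a • b • x
        rw [← mul_smul, ← mul_smul, (hb a).eq] }
  obtain ⟨c, hc⟩ := (IsSimpleModule.algebraMap_end_bijective_of_isAlgClosed k).2 T
  refine ⟨c, ?_⟩
  rw [Algebra.smul_def]
  refine hf.mul_eq_mul_of_smul fun x => ?_
  rw [algebraMap_smul]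
  exact (LinearMap.congr_fun hc x).symm

theorem IsBlockIdempotent.exists_trace_eq {f : R} (hf : IsBlockIdempotent M f)
    (τ : Module.Dual k R) (hτ : ∀ a b, τ (a * b) = τ (b * a)) :
    ∃ κ : k, ∀ b, τ (b * f) = κ * LinearMap.trace k M (Algebra.lsmul k k M b) := by
  obtain ⟨s, hs⟩ := (Algebra.lsmul k k M : R →ₐ[k] _).toLinearMap.exists_rightInverse_of_surjective
    (LinearMap.range_eq_top.2 (lsmul_surjective k R M))
  have hs' : ∀ X, Algebra.lsmul k k M (s X) = X := LinearMap.congr_fun hs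
  have hs_smul : ∀ X (x : M), s X • x = X x := fun X => LinearMap.congr_fun (hs' X)
  have hmul : ∀ X Y, s (X * Y) * f = s X * s Y * f := fun X Y =>
    hf.mul_eq_mul_of_smul fun x => by
      rw [mul_smul, hs_smul, hs_smul, hs_smul, Module.End.mul_apply]
  obtain ⟨κ, hκ⟩ := exists_eq_mul_trace (τ ∘ₗ LinearMap.mulRight k f ∘ₗ s) fun X Y => by
    calc τ (s (X * Y) * f) = τ (s X * (s Y * f)) := by rw [hmul, mul_assoc]
      _ = τ (s Y * (f * s X)) := by rw [hτ, mul_assoc]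
      _ = τ (s (Y * X) * f) := by rw [hmul, (hf.commute _).eq, mul_assoc]
  refine ⟨κ, fun b => ?_⟩
  rw [← hκ, ← hf.mul_eq_mul_of_smul (hs_smul (Algebra.lsmul k k M b))]
  rfl

end Burnside

/-! ### The graded components and the functional `λ` -/

section Graded

variable {m : ℕ} {A : Type u} [Ring A] [Algebra ℂ A] {𝒜 : ZMod m → Submodule ℂ A}
  [GradedAlgebra 𝒜] {r s t : ZMod m} {a b : A}

theorem coe_gradeProj_of_mem (ha : a ∈ 𝒜 r) : (gradeProj 𝒜 r a : A) = a :=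
  DirectSum.decompose_of_mem_same 𝒜 ha

theorem gradeProj_of_mem_of_ne (ha : a ∈ 𝒜 s) (h : s ≠ r) : gradeProj 𝒜 r a = 0 :=
  Subtype.ext (DirectSum.decompose_of_mem_ne 𝒜 ha h)

theorem coe_gradeProj_mul_of_left_mem (ha : a ∈ 𝒜 r) (b : A) (h : r + s = t) :
    (gradeProj 𝒜 t (a * b) : A) = a * gradeProj 𝒜 s b :=
  h ▸ DirectSum.coe_decompose_mul_add_of_left_mem 𝒜 ha

theorem coe_gradeProj_mul_of_right_mem (a : A) (hb : b ∈ 𝒜 s) (h : r + s = t) :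
    (gradeProj 𝒜 t (a * b) : A) = gradeProj 𝒜 r a * b :=
  h ▸ DirectSum.coe_decompose_mul_add_of_right_mem 𝒜 hb

theorem extendByZero_comp_subtype (γ : Module.Dual ℂ (𝒜 r)) :
    extendByZero 𝒜 r γ ∘ₗ (𝒜 r).subtype = γ :=
  LinearMap.ext fun x => congrArg γ (Subtype.ext (coe_gradeProj_of_mem x.2))

theorem graded_induction {P : A → Prop} (hmem : ∀ r, ∀ a ∈ 𝒜 r, P a)
    (hadd : ∀ a b, P a → P b → P (a + b)) (a : A) : P a := by
  induction a using DirectSum.Decomposition.inductionOn 𝒜 with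
  | zero => exact hmem 0 0 (zero_mem _)
  | homogeneous x => exact hmem _ _ x.2
  | add x y hx hy => exact hadd _ _ hx hy

namespace FrobeniusStar

variable [StarRing A] [StarModule ℂ A] (F : FrobeniusStar 𝒜)

theorem lam_eq_lam_of_coe_gradeProj_eq (h : (gradeProj 𝒜 0 a : A) = gradeProj 𝒜 0 b) :
    F.lam a = F.lam b :=
  congrArg F.lam0 (Subtype.ext h)

theorem lam_mul_comm (ha : a ∈ 𝒜 0) (b : A) : F.lam (a * b) = F.lam (b * a) := by
  have hleft : gradeProj 𝒜 0 (a * b) = ⟨a, ha⟩ * gradeProj 𝒜 0 b :=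
    Subtype.ext (coe_gradeProj_mul_of_left_mem ha b (add_zero 0))
  have hright : gradeProj 𝒜 0 (b * a) = gradeProj 𝒜 0 b * ⟨a, ha⟩ :=
    Subtype.ext (coe_gradeProj_mul_of_right_mem b ha (add_zero 0))
  calc F.lam (a * b) = F.lam0 (⟨a, ha⟩ * gradeProj 𝒜 0 b) := congrArg F.lam0 hleft
    _ = F.lam0 (gradeProj 𝒜 0 b * ⟨a, ha⟩) := F.lam0_mul_comm _ _
    _ = F.lam (b * a) := (congrArg F.lam0 hright).symm

theorem lam_mul_gradeProj_neg (a b : A) (r : ZMod m) :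
    F.lam (a * gradeProj 𝒜 (-r) b) = F.lam (gradeProj 𝒜 r a * b) := by
  refine F.lam_eq_lam_of_coe_gradeProj_eq ?_
  rw [coe_gradeProj_mul_of_right_mem a (gradeProj 𝒜 (-r) b).2 (add_neg_cancel r),
    coe_gradeProj_mul_of_left_mem (gradeProj 𝒜 r a).2 b (add_neg_cancel r)]

include F in
theorem star_mem_zero (ha : a ∈ 𝒜 0) : star a ∈ 𝒜 0 := by
  simpa using F.star_mem 0 a ha

theorem lam_mul_star_pos (ha : a ≠ 0) : 0 < (F.lam (a * star a)).re := F.pos a ha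

theorem lam_mul_star_ne_zero (ha : a ≠ 0) : F.lam (a * star a) ≠ 0 := fun h => by
  have hpos := F.lam_mul_star_pos ha
  rw [h, Complex.zero_re] at hpos
  exact hpos.false

include F in
theorem eq_zero_of_mul_star (h : a * star a = 0) : a = 0 :=
  by_contra fun ha => F.lam_mul_star_ne_zero ha (by rw [h, map_zero])

include F in
theorem eq_zero_of_star_mul (h : star a * a = 0) : a = 0 :=
  star_eq_zero.1 (F.eq_zero_of_mul_star (by rwa [star_star]))

include F in
theorem star_eq_self_of_mul_self (hidem : a * a = a) (hcomm : Commute a (star a)) :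
    star a = a := by
  have h : a - star a * a = 0 := F.eq_zero_of_mul_star <| by
    calc (a - star a * a) * star (a - star a * a)
        = (1 - star a) * (a * star a) * (1 - a) := by
          simp only [star_sub, star_mul, star_star]; noncomm_ring
      _ = (1 - star a) * star a * (a - a * a) := by rw [hcomm.eq]; noncomm_ring
      _ = 0 := by rw [hidem, sub_self, mul_zero]
  rw [sub_eq_zero] at h
  rw [h, star_mul, star_star, ← h]

variable [FiniteDimensional ℂ A]

include F in
theorem isSemisimpleRing : IsSemisimpleRing A :=
  have : IsArtinianRing A := IsArtinianRing.of_finite ℂ A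
  isSemisimpleRing_of_proper_involution star_mul star_star fun _ => F.eq_zero_of_star_mul

include F in
theorem isSemisimpleRing_zero : IsSemisimpleRing (𝒜 0) :=
  have : IsArtinianRing (𝒜 0) := IsArtinianRing.of_finite ℂ (𝒜 0)
  isSemisimpleRing_of_proper_involution (σ := fun a => ⟨star (a : A), F.star_mem_zero a.2⟩)
    (fun a b => Subtype.ext (star_mul (a : A) b)) (fun a => Subtype.ext (star_star (a : A)))
    fun _ h => Subtype.ext (F.eq_zero_of_star_mul (congrArg Subtype.val h))

theorem phi_apply (a x : A) : F.phi a x = F.lam (x * a) := rfl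

theorem lam_mul_phi_symm (γ : Module.Dual ℂ A) (x : A) : F.lam (x * F.phi.symm γ) = γ x := by
  rw [← phi_apply, LinearEquiv.apply_symm_apply]

theorem phi_symm_extendByZero (γ : Module.Dual ℂ A) (r : ZMod m) :
    F.phi.symm (extendByZero 𝒜 r (γ ∘ₗ (𝒜 r).subtype)) = gradeProj 𝒜 (-r) (F.phi.symm γ) := by
  rw [LinearEquiv.symm_apply_eq]
  ext x
  rw [phi_apply, lam_mul_gradeProj_neg, lam_mul_phi_symm]
  rfl

theorem phi_symm_extendByZero_mem (γ : Module.Dual ℂ (𝒜 r)) :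
    F.phi.symm (extendByZero 𝒜 r γ) ∈ 𝒜 (-r) := by
  rw [← extendByZero_comp_subtype γ, phi_symm_extendByZero]
  exact (gradeProj 𝒜 (-r) _).2

theorem phi_symm_extendByZero_injective :
    Function.Injective fun γ : Module.Dual ℂ (𝒜 r) => F.phi.symm (extendByZero 𝒜 r γ) := by
  intro γ δ h
  rw [← extendByZero_comp_subtype γ, ← extendByZero_comp_subtype δ, F.phi.symm.injective h]

theorem commute_phi_symm_extendByZero {γ : Module.Dual ℂ (𝒜 r)}
    (hγ : γ ∈ twistedClassFunctionals 𝒜 r) (ha : a ∈ 𝒜 0) :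
    Commute a (F.phi.symm (extendByZero 𝒜 r γ)) := by
  set z := F.phi.symm (extendByZero 𝒜 r γ)
  have hlam : ∀ x, F.lam (x * z) = γ (gradeProj 𝒜 r x) := F.lam_mul_phi_symm _
  refine F.phi.injective (LinearMap.ext fun x => ?_)
  have hleft : gradeProj 𝒜 r (a * x)
      = ⟨a * gradeProj 𝒜 r x, zero_mul_mem ⟨a, ha⟩ (gradeProj 𝒜 r x).2⟩ :=
    Subtype.ext (coe_gradeProj_mul_of_left_mem ha x (zero_add r))
  have hright : gradeProj 𝒜 r (x * a)
      = ⟨gradeProj 𝒜 r x * a, mul_zero_mem ⟨a, ha⟩ (gradeProj 𝒜 r x).2⟩ :=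
    Subtype.ext (coe_gradeProj_mul_of_right_mem x ha (add_zero r))
  calc F.lam (x * (a * z)) = γ (gradeProj 𝒜 r (x * a)) := by rw [← mul_assoc, hlam]
    _ = γ (gradeProj 𝒜 r (a * x)) := by rw [hleft, hright]; exact (hγ ⟨a, ha⟩ _).symm
    _ = F.lam (a * (x * z)) := by rw [← hlam, mul_assoc]
    _ = F.lam (x * (z * a)) := by rw [F.lam_mul_comm ha, mul_assoc]

end FrobeniusStar

end Graded

/-! ### Graded unitary representations -/

section GradedUnitaryRep

variable {m : ℕ} {A : Type u} [Ring A] [Algebra ℂ A] [StarRing A]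

/-- `w` is a homogeneous representation of `ℤ/mℤ` by unitary elements of a corner of `A` which
commute with `𝒜 0`. The unit of the corner is `w 0`, which need not be `1`. -/
structure IsGradedUnitaryRep (𝒜 : ZMod m → Submodule ℂ A) (w : ZMod m → A) : Prop where
  mem : ∀ r, w r ∈ 𝒜 r
  commute_zero : ∀ a ∈ 𝒜 0, ∀ r, Commute a (w r)
  mul : ∀ r s, w r * w s = w (r + s)
  star_eq : ∀ r, star (w r) = w (-r)

namespace IsGradedUnitaryRep

variable {𝒜 : ZMod m → Submodule ℂ A} {w : ZMod m → A} (hw : IsGradedUnitaryRep 𝒜 w) {r s : ZMod m}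
include hw

protected theorem zero_mul (r : ZMod m) : w 0 * w r = w r := by rw [hw.mul, zero_add]

protected theorem mul_zero (r : ZMod m) : w r * w 0 = w r := by rw [hw.mul, add_zero]

theorem mul_neg_mul (a : A) (r : ZMod m) : a * w (-r) * w r = a * w 0 := by
  rw [mul_assoc, hw.mul, neg_add_cancel]

theorem addChar_smul [StarModule ℂ A] (χ : AddChar (ZMod m) ℂ) [NeZero m] :
    IsGradedUnitaryRep 𝒜 fun r => χ (-r) • w r where
  mem r := Submodule.smul_mem _ _ (hw.mem r)
  commute_zero a ha r := (hw.commute_zero a ha r).smul_right _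
  mul r s := by
    rw [smul_mul_smul_comm, hw.mul, ← AddChar.map_add_eq_mul, neg_add]
  star_eq r := by
    rw [star_smul, hw.star_eq, neg_neg, AddChar.map_neg_eq_conj, Complex.star_def,
      Complex.conj_conj]

section Sum

variable [NeZero m]

protected theorem mul_sum (s : ZMod m) : w s * ∑ r, w r = ∑ r, w r := by
  rw [Finset.mul_sum]
  exact Fintype.sum_equiv (Equiv.addLeft s) _ _ fun r => hw.mul s r

theorem sum_mul_sum : (∑ r, w r) * ∑ r, w r = (m : ℂ) • ∑ r, w r := by
  simp_rw [Finset.sum_mul _ _ (∑ r, w r), hw.mul_sum, Finset.sum_const, Finset.card_univ,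
    ZMod.card, Nat.cast_smul_eq_nsmul]

protected theorem star_sum : star (∑ r, w r) = ∑ r, w r := by
  rw [_root_.star_sum]
  exact Fintype.sum_equiv (Equiv.neg _) _ _ hw.star_eq

end Sum

variable [GradedAlgebra 𝒜]

theorem mul_neg_mem_zero {a : A} (ha : a ∈ 𝒜 r) : a * w (-r) ∈ 𝒜 0 := by
  simpa using SetLike.mul_mem_graded ha (hw.mem (-r))

theorem commute_zero_apply (a : A) : Commute a (w 0) := by
  have hcorner : ∀ a, w 0 * a * w 0 = a * w 0 := by
    intro a
    induction a using graded_induction (𝒜 := 𝒜) with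
    | hmem r a ha =>
      rw [mul_assoc, ← hw.mul_neg_mul a r, ← mul_assoc,
        ← (hw.commute_zero _ (hw.mul_neg_mem_zero ha) 0).eq, mul_assoc, hw.zero_mul]
    | hadd a b ha hb => rw [mul_add, add_mul, ha, hb, add_mul]
  have hstar : w 0 * a * w 0 = w 0 * a := by
    simpa [hw.star_eq, mul_assoc] using congrArg star (hcorner (star a))
  exact (hcorner a).symm.trans hstar

protected theorem commute (a : A) (s : ZMod m) : Commute a (w s) := by
  induction a using graded_induction (𝒜 := 𝒜) with
  | hmem r a ha =>
    calc a * w s = a * w 0 * w s := by rw [mul_assoc, hw.zero_mul]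
      _ = a * w (-r) * (w s * w r) := by
        rw [← hw.mul_neg_mul a r, mul_assoc, hw.mul, hw.mul, add_comm]
      _ = w s * (a * w (-r)) * w r := by
        rw [← mul_assoc, (hw.commute_zero _ (hw.mul_neg_mem_zero ha) s).eq]
      _ = w s * (a * w 0) := by rw [mul_assoc, hw.mul_neg_mul]
      _ = w s * a := by rw [(hw.commute_zero_apply a).eq, ← mul_assoc, hw.mul_zero]
  | hadd a b ha hb => exact ha.add_left hb

variable [NeZero m]

theorem commute_sum (a : A) : Commute a (∑ r, w r) :=
  Commute.sum_right _ _ _ fun r _ => hw.commute a r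

theorem coe_gradeProj_sum (r : ZMod m) : (gradeProj 𝒜 r (∑ s, w s) : A) = w r := by
  rw [map_sum, Finset.sum_eq_single_of_mem r (Finset.mem_univ r) fun s _ hs =>
    gradeProj_of_mem_of_ne (hw.mem s) hs, coe_gradeProj_of_mem (hw.mem r)]

theorem coe_gradeProj_zero_mul_sum {a : A} (ha : a ∈ 𝒜 r) :
    (gradeProj 𝒜 0 (a * ∑ s, w s) : A) = a * w (-r) := by
  rw [coe_gradeProj_mul_of_left_mem ha _ (add_neg_cancel r), hw.coe_gradeProj_sum]

theorem gradeProj_zero_mul_sum_mul_sum (a : A) :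
    (gradeProj 𝒜 0 (a * ∑ r, w r) : A) * ∑ r, w r = a * ∑ r, w r := by
  induction a using graded_induction (𝒜 := 𝒜) with
  | hmem r a ha => rw [hw.coe_gradeProj_zero_mul_sum ha, mul_assoc, hw.mul_sum]
  | hadd a b ha hb => rw [add_mul, map_add, Submodule.coe_add, add_mul, ha, hb]

theorem gradeProj_zero_mul_mul_sum (a b : A) :
    gradeProj 𝒜 0 (a * b * ∑ r, w r)
      = gradeProj 𝒜 0 (a * ∑ r, w r) * gradeProj 𝒜 0 (b * ∑ r, w r) := by
  have hsplit : a * b * ∑ r, w r = a * (∑ r, w r) * gradeProj 𝒜 0 (b * ∑ r, w r) := by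
    rw [mul_assoc a (∑ r, w r), ← (hw.commute_sum _).eq, hw.gradeProj_zero_mul_sum_mul_sum,
      mul_assoc]
  refine Subtype.ext ?_
  rw [hsplit, SetLike.GradeZero.coe_mul]
  exact coe_gradeProj_mul_of_right_mem _ (gradeProj 𝒜 0 (b * ∑ r, w r)).2 (add_zero 0)

end IsGradedUnitaryRep

theorem isGradedUnitaryRep_pow [NeZero m] {𝒜 : ZMod m → Submodule ℂ A} [SetLike.GradedMonoid 𝒜]
    {u : A} (hu : u ∈ 𝒜 1) (hcomm : ∀ a ∈ 𝒜 0, Commute a u) (hstar : star u * u = u ^ m)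
    (hpow : u ^ (m + 1) = u) : IsGradedUnitaryRep 𝒜 fun r => u ^ (m + r.val) := by
  have hunit (k : ℕ) : u ^ m * u ^ (m + k) = u ^ (m + k) := by
    obtain ⟨n, hn⟩ := Nat.exists_eq_add_one_of_ne_zero (NeZero.ne m)
    calc u ^ m * u ^ (m + k) = u ^ (m + 1) * u ^ (n + k) := by
          rw [← pow_add, ← pow_add]; congr 1; omega
      _ = u ^ (m + k) := by rw [hpow, ← pow_succ']; congr 1; omega
  have hperiodic : Function.Periodic (fun k => u ^ (m + k)) m := fun k => by
    calc u ^ (m + (k + m)) = u ^ m * u ^ (m + k) := by rw [← pow_add]; congr 1; omega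
      _ = u ^ (m + k) := hunit k
  have hmul (r s : ZMod m) : u ^ (m + r.val) * u ^ (m + s.val) = u ^ (m + (r + s).val) := by
    calc u ^ (m + r.val) * u ^ (m + s.val) = u ^ m * u ^ (m + (r.val + s.val)) := by
          rw [← pow_add, ← pow_add]; congr 1; omega
      _ = u ^ (m + (r.val + s.val) % m) := by rw [hunit]; exact (hperiodic.map_mod_nat _).symm
      _ = u ^ (m + (r + s).val) := by rw [ZMod.val_add]
  have hstar_pow : star (u ^ m) = u ^ m := by rw [← hstar, star_mul, star_star]
  have hstar_mul (k : ℕ) : star (u ^ (m + k)) * u ^ (m + k) = u ^ m := by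
    induction k with
    | zero => simpa [hstar_pow] using hunit 0
    | succ k ih => rw [← add_assoc, pow_succ', star_mul, mul_assoc, ← mul_assoc (star u), hstar,
        hunit, ih]
  refine ⟨fun r => ?_, fun a ha r => (hcomm a ha).pow_right _, hmul, fun r => ?_⟩
  · simpa using SetLike.pow_mem_graded (m + r.val) hu
  · calc star (u ^ (m + r.val)) = star (u ^ (m + r.val)) * u ^ m := by
          conv_lhs => rw [← hunit, star_mul, hstar_pow]
      _ = star (u ^ (m + r.val)) * u ^ (m + r.val) * u ^ (m + (-r).val) := by
          rw [mul_assoc, hmul, add_neg_cancel, ZMod.val_zero, add_zero]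
      _ = u ^ (m + (-r).val) := by rw [hstar_mul, hunit]

end GradedUnitaryRep

section Construction

variable {m : ℕ} {A : Type u} [Ring A] [Algebra ℂ A] [StarRing A] [StarModule ℂ A]
  {𝒜 : ZMod m → Submodule ℂ A}

theorem exists_pow_mul_eq_one_and_norm_sq_mul_eq_one [NeZero m] {c : ℝ} {d : ℂ} (hc : 0 < c)
    (h : ‖d‖ ^ 2 = c ^ m) : ∃ s : ℂ, s ^ m * d = 1 ∧ ‖s‖ ^ 2 * c = 1 := by
  have hd : d ≠ 0 := fun h0 => by
    rw [h0, norm_zero, zero_pow two_ne_zero] at h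
    exact (pow_pos hc m).ne h
  obtain ⟨s, hs⟩ := IsAlgClosed.exists_pow_nat_eq d⁻¹ (NeZero.pos m)
  have hsd : s ^ m * d = 1 := by rw [hs, inv_mul_cancel₀ hd]
  refine ⟨s, hsd, ?_⟩
  rw [← pow_eq_one_iff_of_nonneg (by positivity) (NeZero.ne m), mul_pow, ← h, ← pow_mul,
    mul_comm 2, pow_mul, ← mul_pow, ← norm_pow, ← norm_mul, hsd, norm_one, one_pow]

theorem exists_isGradedUnitaryRep_of_star_mul [NeZero m] [SetLike.GradedMonoid 𝒜] {f v : A}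
    {c : ℝ} {d : ℂ} (hv : v ∈ 𝒜 1) (hcomm : ∀ a ∈ 𝒜 0, Commute a v) (hf : f ≠ 0)
    (hfstar : star f = f) (hff : f * f = f) (hfv : f * v = v) (hc : 0 < c)
    (hstar : star v * v = (c : ℂ) • f) (hpow : v ^ m = d • f) :
    ∃ w, IsGradedUnitaryRep 𝒜 w ∧ w 0 = f := by
  have hf_pow (k : ℕ) (hk : k ≠ 0) : f * v ^ k = v ^ k := by
    obtain ⟨n, rfl⟩ := Nat.exists_eq_add_one_of_ne_zero hk
    rw [pow_succ', ← mul_assoc, hfv]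
  have hstar_pow (k : ℕ) : star (v ^ (k + 1)) * v ^ (k + 1) = ((c : ℂ) ^ (k + 1)) • f := by
    induction k with
    | zero => simpa using hstar
    | succ k ih =>
      rw [pow_succ' v, star_mul, mul_assoc, ← mul_assoc (star v), hstar, smul_mul_assoc,
        hf_pow _ k.succ_ne_zero, mul_smul_comm, ih, smul_smul, ← pow_succ']
  have hnorm : ‖d‖ ^ 2 = c ^ m := by
    obtain ⟨n, hn⟩ := Nat.exists_eq_add_one_of_ne_zero (NeZero.ne m)
    have h := hstar_pow n
    rw [← hn, hpow, star_smul, hfstar, smul_mul_smul_comm, hff] at h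
    have hd : star d * d = (c : ℂ) ^ m := smul_left_injective ℂ hf h
    rw [← Complex.ofReal_inj, Complex.ofReal_pow, Complex.ofReal_pow, ← hd, Complex.star_def,
      Complex.conj_mul']
  obtain ⟨s, hsd, hsc⟩ := exists_pow_mul_eq_one_and_norm_sq_mul_eq_one (m := m) hc hnorm
  have hu_pow : (s • v) ^ m = f := by rw [smul_pow, hpow, smul_smul, hsd, one_smul]
  refine ⟨_, isGradedUnitaryRep_pow (u := s • v) (Submodule.smul_mem _ s hv)
    (fun a ha => (hcomm a ha).smul_right s) ?_ ?_, ?_⟩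
  · rw [hu_pow, star_smul, smul_mul_smul_comm, hstar, smul_smul, Complex.star_def,
      Complex.conj_mul', ← Complex.ofReal_pow, ← Complex.ofReal_mul, hsc, Complex.ofReal_one,
      one_smul]
  · rw [pow_succ, hu_pow, mul_smul_comm, hfv]
  · simpa using hu_pow

variable [GradedAlgebra 𝒜] (F : FrobeniusStar 𝒜)

namespace FrobeniusStar

include F in
theorem exists_pos_of_star_mul_self_eq_smul {f v : A} {c : ℂ} (hv : v ≠ 0) (hfstar : star f = f)
    (hff : f * f = f) (h : star v * v = c • f) : ∃ c' : ℝ, 0 < c' ∧ c = c' := by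
  have hf : f ≠ 0 := fun hf => hv (F.eq_zero_of_star_mul (by rw [h, hf, smul_zero]))
  have hreal : star c = c := smul_left_injective ℂ hf <| by
    calc star c • f = star (star v * v) := by rw [h, star_smul, hfstar]
      _ = c • f := by rw [star_mul, star_star, h]
  obtain ⟨c', rfl⟩ := Complex.conj_eq_iff_real.1 hreal
  have hlam_v : 0 < (F.lam (star v * v)).re := by
    simpa using F.lam_mul_star_pos (star_ne_zero.2 hv)
  have hlam_f : 0 < (F.lam f).re := by
    simpa [hfstar, hff] using F.lam_mul_star_pos hf
  rw [h, map_smul, smul_eq_mul, Complex.re_ofReal_mul] at hlam_v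
  exact ⟨c', pos_of_mul_pos_left hlam_v hlam_f.le, rfl⟩

variable {M : Type*} [AddCommGroup M] [Module (𝒜 0) M] {f : 𝒜 0}

include F in
theorem star_coe_of_isBlockIdempotent (hf : IsBlockIdempotent M f) : star (f : A) = f :=
  F.star_eq_self_of_mul_self (congrArg Subtype.val hf.mul_self)
    (congrArg Subtype.val (hf.commute ⟨star (f : A), F.star_mem_zero f.2⟩).eq)

variable [NeZero m] [Module ℂ M] [IsScalarTower ℂ (𝒜 0) M] [IsSimpleModule (𝒜 0) M]
  [FiniteDimensional ℂ M]

include F in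
theorem exists_isGradedUnitaryRep (hf : IsBlockIdempotent M f) {v : A}
    (hv : v ∈ 𝒜 1) (hv0 : v ≠ 0) (hcomm : ∀ a ∈ 𝒜 0, Commute a v) (hvf : v * f = v) :
    ∃ w, IsGradedUnitaryRep 𝒜 w ∧ w 0 = f := by
  have hscalar {b : A} (hb : b ∈ 𝒜 0) (hbcomm : ∀ a ∈ 𝒜 0, Commute a b) :
      ∃ c : ℂ, b * f = c • f := by
    have hb_comm (a : 𝒜 0) : a * ⟨b, hb⟩ = ⟨b, hb⟩ * a := Subtype.ext (hbcomm a a.2).eq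
    obtain ⟨c, hc⟩ := hf.exists_mul_eq_smul ℂ hb_comm
    exact ⟨c, congrArg Subtype.val hc⟩
  have hcomm_star : ∀ a ∈ 𝒜 0, Commute a (star v) := fun a ha => by
    simpa using (hcomm _ (F.star_mem_zero ha)).star_star
  have hstar_mem : star v * v ∈ 𝒜 0 := by
    simpa using SetLike.mul_mem_graded (F.star_mem 1 v hv) hv
  have hpow_mem : v ^ m ∈ 𝒜 0 := by
    simpa using SetLike.pow_mem_graded m hv
  have hf0 : (f : A) ≠ 0 := fun h => hv0 (by rw [← hvf, h, mul_zero])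
  have hfstar := F.star_coe_of_isBlockIdempotent hf
  have hff : (f : A) * f = f := congrArg Subtype.val hf.mul_self
  have hpow_f : v ^ m * f = v ^ m := by
    rw [← pow_sub_one_mul (NeZero.ne m), mul_assoc, hvf]
  obtain ⟨c, hc⟩ := hscalar hstar_mem fun a ha => (hcomm_star a ha).mul_right (hcomm a ha)
  obtain ⟨d, hd⟩ := hscalar hpow_mem fun a ha => (hcomm a ha).pow_right m
  rw [mul_assoc, hvf] at hc
  rw [hpow_f] at hd
  obtain ⟨c, hcpos, rfl⟩ := F.exists_pos_of_star_mul_self_eq_smul hv0 hfstar hff hc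
  exact exists_isGradedUnitaryRep_of_star_mul hv hcomm hf0 hfstar hff
    ((hcomm _ f.2).eq.trans hvf) hcpos hc hd

end FrobeniusStar

end Construction

/-! ### Extensions and their characters -/

section Extension

variable {m : ℕ} {A : Type u} [Ring A] [Algebra ℂ A] {𝒜 : ZMod m → Submodule ℂ A}
  [GradedAlgebra 𝒜] {M : Type v} [AddCommGroup M] [Module ℂ M] [Module (𝒜 0) M]

theorem IsGradedUnitaryRep.nonempty_extension [NeZero m] [IsScalarTower ℂ (𝒜 0) M] [StarRing A]
    {w : ZMod m → A} (hw : IsGradedUnitaryRep 𝒜 w)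
    (hone : ∀ x : M, (⟨w 0, hw.mem 0⟩ : 𝒜 0) • x = x) : Nonempty (Extension 𝒜 M) := by
  have hzero (a : 𝒜 0) : gradeProj 𝒜 0 (a * ∑ r, w r) = a * ⟨w 0, hw.mem 0⟩ := Subtype.ext <| by
    rw [hw.coe_gradeProj_zero_mul_sum a.2, neg_zero, SetLike.GradeZero.coe_mul]
  have haction_zero (a : 𝒜 0) (x : M) : gradeProj 𝒜 0 (a * ∑ r, w r) • x = a • x := by
    rw [hzero, mul_smul, hone]
  exact ⟨{
    action := AlgHom.ofLinearMap ((Algebra.lsmul ℂ ℂ M : 𝒜 0 →ₐ[ℂ] Module.End ℂ M).toLinearMap ∘ₗ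
        gradeProj 𝒜 0 ∘ₗ LinearMap.mulRight ℂ (∑ r, w r))
      (LinearMap.ext fun x => (haction_zero 1 x).trans (one_smul _ x))
      (fun a b => LinearMap.ext fun x => by
        change gradeProj 𝒜 0 (a * b * ∑ r, w r) • x = _
        rw [hw.gradeProj_zero_mul_mul_sum, mul_smul]
        rfl)
    action_zero := haction_zero }⟩

namespace Extension

variable (E : Extension 𝒜 M)

theorem space_smul_def (a : A) (x : E.Space) : a • x = E.action a x := rfl

theorem isSimpleModule_space [IsSimpleModule (𝒜 0) M] : IsSimpleModule A E.Space := by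
  have hnontrivial : Nontrivial M := IsSimpleModule.nontrivial (𝒜 0) M
  have hcyclic (x : M) (hx : x ≠ 0) (y : M) : ∃ b : 𝒜 0, b • x = y :=
    IsSimpleModule.toSpanSingleton_surjective (𝒜 0) hx y
  refine isSimpleModule_iff_toSpanSingleton_surjective.2 ⟨hnontrivial, fun x hx y => ?_⟩
  obtain ⟨b, hb⟩ := hcyclic x hx y
  exact ⟨b, (E.action_zero b x).trans hb⟩

theorem exists_action_eq_smul [IsScalarTower ℂ (𝒜 0) M] [IsSimpleModule (𝒜 0) M]
    [FiniteDimensional ℂ M] (E : Extension 𝒜 M) {b : A} (hb : ∀ a ∈ 𝒜 0, Commute a b) :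
    ∃ c : ℂ, E.action b = c • 1 := by
  let T : Module.End (𝒜 0) M :=
    { E.action b with
      map_smul' := fun a x => by
        change E.action b (a • x) = a • E.action b x
        rw [← E.action_zero, ← E.action_zero, ← Module.End.mul_apply, ← Module.End.mul_apply,
          ← map_mul, ← map_mul, (hb a a.2).eq] }
  obtain ⟨c, hc⟩ := (IsSimpleModule.algebraMap_end_bijective_of_isAlgClosed ℂ).2 T
  exact ⟨c, LinearMap.ext fun x => (LinearMap.congr_fun hc x).symm⟩

theorem twistedCharacter_mem :
    E.twistedCharacter ∈ twistedClassFunctionals 𝒜 1 := fun a x => by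
  change LinearMap.trace ℂ M (E.action (a * x)) = LinearMap.trace ℂ M (E.action (x * a))
  rw [map_mul E.action, map_mul E.action, LinearMap.trace_mul_comm]

/-- `w` is a graded unitary representation in the block of `M`, on whose image `E` is trivial. The
action of `A` on `M` through `E` is then `a • x = π₀ (a ∑ w r) • x`, with `π₀` the projection
to `𝒜 0`. -/
structure IsAdapted [StarRing A] (w : ZMod m → A) : Prop extends IsGradedUnitaryRep 𝒜 w where
  isBlockIdempotent : IsBlockIdempotent M (⟨w 0, mem 0⟩ : 𝒜 0)
  action_eq_one : ∀ r, E.action (w r) = 1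

variable {E} [StarRing A] {w : ZMod m → A}

theorem exists_isAdapted [NeZero m] [StarModule ℂ A] [IsScalarTower ℂ (𝒜 0) M]
    [IsSimpleModule (𝒜 0) M] [FiniteDimensional ℂ M] (E : Extension 𝒜 M)
    (hw : IsGradedUnitaryRep 𝒜 w) (hblock : IsBlockIdempotent M (⟨w 0, hw.mem 0⟩ : 𝒜 0)) :
    ∃ w', E.IsAdapted w' := by
  have : Nontrivial M := IsSimpleModule.nontrivial (𝒜 0) M
  choose χ hχ using fun r => E.exists_action_eq_smul fun a ha => hw.commute_zero a ha r
  have hχ_zero : χ 0 = 1 := smul_left_injective ℂ (one_ne_zero (α := Module.End ℂ M)) <| by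
    change χ 0 • 1 = (1 : ℂ) • 1
    rw [← hχ, one_smul]
    exact LinearMap.ext fun x => (E.action_zero ⟨w 0, hw.mem 0⟩ x).trans (hblock.smul_eq x)
  have hχ_add (r s : ZMod m) : χ (r + s) = χ r * χ s :=
    smul_left_injective ℂ (one_ne_zero (α := Module.End ℂ M)) <| by
      change χ (r + s) • 1 = (χ r * χ s) • 1
      rw [← hχ, ← hw.mul, map_mul, hχ, hχ, smul_mul_smul_comm, one_mul]
  let ψ : AddChar (ZMod m) ℂ := ⟨χ, hχ_zero, hχ_add⟩
  have hψ_zero : (ψ (-0) • w 0) = w 0 := by rw [neg_zero, AddChar.map_zero_eq_one, one_smul]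
  refine ⟨_, hw.addChar_smul ψ, ?_, fun r => ?_⟩
  · simpa only [hψ_zero] using hblock
  · change E.action (χ (-r) • w r) = 1
    rw [map_smul, hχ, smul_smul, ← hχ_add, neg_add_cancel, hχ_zero, one_smul]

variable [NeZero m]

namespace IsAdapted

theorem action_eq (hw : E.IsAdapted w) (a : A) (x : M) :
    E.action a x = gradeProj 𝒜 0 (a * ∑ r, w r) • x := by
  induction a using graded_induction (𝒜 := 𝒜) with
  | hmem r a ha =>
    rw [← E.action_zero, hw.coe_gradeProj_zero_mul_sum ha, map_mul, hw.action_eq_one, mul_one]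
  | hadd a b ha hb => rw [map_add, LinearMap.add_apply, ha, hb, add_mul, map_add, add_smul]

theorem mul_sum_eq_zero (hw : E.IsAdapted w) {a : A} (ha : E.action a = 0) :
    a * ∑ r, w r = 0 := by
  have hproj : gradeProj 𝒜 0 (a * ∑ r, w r) * ⟨w 0, hw.mem 0⟩ = 0 :=
    hw.isBlockIdempotent.mul_eq_zero_of_smul fun x => by rw [← hw.action_eq, ha]; rfl
  calc a * ∑ r, w r = gradeProj 𝒜 0 (a * ∑ r, w r) * (w 0 * ∑ r, w r) := by
        rw [hw.mul_sum, hw.gradeProj_zero_mul_sum_mul_sum]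
    _ = ↑(gradeProj 𝒜 0 (a * ∑ r, w r) * ⟨w 0, hw.mem 0⟩) * ∑ r, w r := (mul_assoc _ _ _).symm
    _ = 0 := by rw [hproj, ZeroMemClass.coe_zero, zero_mul]

theorem isBlockIdempotent_sum [IsSimpleModule (𝒜 0) M] [IsSemisimpleRing A]
    (hw : E.IsAdapted w) : IsBlockIdempotent E.Space ((m : ℂ)⁻¹ • ∑ r, w r) := by
  have hone : E.action ((m : ℂ)⁻¹ • ∑ r, w r) = 1 := by
    rw [map_smul, map_sum, Finset.sum_congr rfl fun r _ => hw.action_eq_one r, Finset.sum_const,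
      Finset.card_univ, ZMod.card, ← Nat.cast_smul_eq_nsmul ℂ, smul_smul,
      inv_mul_cancel₀ (Nat.cast_ne_zero.2 (NeZero.ne m)), one_smul]
  have := E.isSimpleModule_space
  obtain ⟨e, he⟩ := exists_isBlockIdempotent A E.Space
  have hleft : ((m : ℂ)⁻¹ • ∑ r, w r) * e = e := by
    conv_rhs => rw [← one_mul e]
    exact he.mul_eq_mul_of_smul fun x => by rw [one_smul, E.space_smul_def, hone]; rfl
  have hright : e * ((m : ℂ)⁻¹ • ∑ r, w r) = (m : ℂ)⁻¹ • ∑ r, w r := by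
    have h : (1 - e) * ∑ r, w r = 0 := hw.mul_sum_eq_zero <| by
      rw [map_sub, map_one, sub_eq_zero]
      exact LinearMap.ext fun x => (he.smul_eq x).symm
    rw [sub_mul, one_mul, sub_eq_zero] at h
    rw [mul_smul_comm, ← h]
  rwa [← hright, (he.commute _).eq, hleft]

theorem isCentralIdempotent [IsSimpleModule (𝒜 0) M] [IsSemisimpleRing A] (hw : E.IsAdapted w) :
    E.IsCentralIdempotent ((m : ℂ)⁻¹ • ∑ r, w r) :=
  have he := hw.isBlockIdempotent_sum
  ⟨Subring.mem_center_iff.2 fun a => (he.commute a).symm, he.mul_self, he.span_eq⟩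

end IsAdapted

end Extension

end Extension

section TwistedCharacter

variable {m : ℕ} {A : Type u} [Ring A] [Algebra ℂ A] [StarRing A] [StarModule ℂ A]
  {𝒜 : ZMod m → Submodule ℂ A} [GradedAlgebra 𝒜] {M : Type v} [AddCommGroup M] [Module ℂ M]
  [Module (𝒜 0) M]

namespace FrobeniusStar

variable (F : FrobeniusStar 𝒜)

theorem form_smul_smul (c d : ℂ) (a b : A) :
    F.form (c • a) (d • b) = c * star d * F.form a b := by
  rw [form, form, star_smul, smul_mul_smul_comm, map_smul, smul_eq_mul]

theorem form_sum_of_isGradedUnitaryRep [NeZero m] {w : ZMod m → A} (hw : IsGradedUnitaryRep 𝒜 w) :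
    F.form (∑ r, w r) (∑ r, w r) = m * F.lam (w 0) := by
  have hlam : F.lam (∑ r, w r) = F.lam (w 0) := F.lam_eq_lam_of_coe_gradeProj_eq <| by
    rw [hw.coe_gradeProj_sum, coe_gradeProj_of_mem (hw.mem 0)]
  rw [form, hw.star_sum, hw.sum_mul_sum, map_smul, hlam, smul_eq_mul]

theorem linearIndependent_of_dualForm_eq_zero [FiniteDimensional ℂ A] {r : ZMod m} {ι : Type*}
    {γ : ι → Module.Dual ℂ (𝒜 r)} (hself : ∀ i, F.dualForm r (γ i) (γ i) ≠ 0)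
    (hortho : ∀ i j, i ≠ j → F.dualForm r (γ i) (γ j) = 0) : LinearIndependent ℂ γ := by
  refine linearIndependent_iff'.2 fun s c hc i hi => ?_
  let B : Module.Dual ℂ (Module.Dual ℂ (𝒜 r)) :=
    F.lam ∘ₗ LinearMap.mulRight ℂ (star (F.phi.symm (extendByZero 𝒜 r (γ i)))) ∘ₗ
      F.phi.symm.toLinearMap ∘ₗ (gradeProj 𝒜 r).dualMap
  have hB (j : ι) (hj : j ≠ i) : c j • B (γ j) = 0 := by
    rw [show B (γ j) = 0 from hortho j i hj, smul_zero]
  have hform : c i • B (γ i) = 0 := calc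
    c i • B (γ i) = ∑ j ∈ s, c j • B (γ j) :=
      (Finset.sum_eq_single_of_mem i hi fun j _ hj => hB j hj).symm
    _ = B (∑ j ∈ s, c j • γ j) := by simp only [map_sum, map_smul]
    _ = 0 := by rw [hc, map_zero]
  exact (smul_eq_zero.1 hform).resolve_right (hself i)

theorem exists_trace_eq_lam0 [IsScalarTower ℂ (𝒜 0) M] [IsSimpleModule (𝒜 0) M]
    [FiniteDimensional ℂ M] {f : 𝒜 0} (hf : IsBlockIdempotent M f) :
    ∃ κ : ℂ, κ ≠ 0 ∧ ∀ b, LinearMap.trace ℂ M (Algebra.lsmul ℂ ℂ M b) = κ * F.lam0 (b * f) := by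
  obtain ⟨κ, hκ⟩ := hf.exists_trace_eq F.lam0 F.lam0_mul_comm
  have : Nontrivial M := IsSimpleModule.nontrivial (𝒜 0) M
  have hκ0 : κ ≠ 0 := by
    rintro rfl
    have hff : gradeProj 𝒜 0 (f * star (f : A)) = f * f := Subtype.ext <| by
      rw [F.star_coe_of_isBlockIdempotent hf, ← SetLike.GradeZero.coe_mul,
        coe_gradeProj_of_mem (f * f).2]
    have hf0 : (f : A) ≠ 0 := fun h => hf.ne_zero (Subtype.ext h)
    refine F.lam_mul_star_ne_zero hf0 ?_
    calc F.lam (f * star (f : A)) = F.lam0 (f * f) := congrArg F.lam0 hff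
      _ = 0 := by rw [hκ, zero_mul]
  exact ⟨κ⁻¹, inv_ne_zero hκ0, fun b => by rw [hκ, inv_mul_cancel_left₀ hκ0]⟩

end FrobeniusStar

namespace Extension

namespace IsAdapted

variable [NeZero m] [FiniteDimensional ℂ A] {E : Extension 𝒜 M} {w : ZMod m → A} {κ : ℂ}

theorem phi_symm_twistedCharacter (hw : E.IsAdapted w) {F : FrobeniusStar 𝒜}
    (hκ : F.phi.symm E.character = κ • ∑ r, w r) :
    F.phi.symm (extendByZero 𝒜 1 E.twistedCharacter) = κ • w (-1) := by
  rw [twistedCharacter, F.phi_symm_extendByZero, hκ, map_smul, Submodule.coe_smul,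
    hw.coe_gradeProj_sum]

theorem dualForm_twistedCharacter_self (hw : E.IsAdapted w) {F : FrobeniusStar 𝒜}
    (hκ : F.phi.symm E.character = κ • ∑ r, w r) :
    F.dualForm 1 E.twistedCharacter E.twistedCharacter = κ * star κ * F.lam (w 0) := by
  rw [FrobeniusStar.dualForm, hw.phi_symm_twistedCharacter hκ, F.form_smul_smul,
    FrobeniusStar.form, hw.star_eq, hw.mul, add_neg_cancel]

variable [IsScalarTower ℂ (𝒜 0) M] [IsSimpleModule (𝒜 0) M]

theorem exists_phi_symm_character (hw : E.IsAdapted w) (F : FrobeniusStar 𝒜) :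
    ∃ κ : ℂ, κ ≠ 0 ∧ F.phi.symm E.character = κ • ∑ r, w r := by
  have : FiniteDimensional ℂ M := Module.Finite.trans (𝒜 0) M
  obtain ⟨κ, hκ0, hκ⟩ := F.exists_trace_eq_lam0 hw.isBlockIdempotent
  refine ⟨κ, hκ0, (LinearEquiv.symm_apply_eq _).2 (LinearMap.ext fun a => ?_)⟩
  have haction : E.action a = Algebra.lsmul ℂ ℂ M (gradeProj 𝒜 0 (a * ∑ r, w r)) :=
    LinearMap.ext (hw.action_eq a)
  have hproj : gradeProj 𝒜 0 (a * ∑ r, w r) * ⟨w 0, hw.mem 0⟩ = gradeProj 𝒜 0 (a * ∑ r, w r) :=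
    Subtype.ext <| by
      rw [SetLike.GradeZero.coe_mul, ← coe_gradeProj_mul_of_right_mem _ (hw.mem 0) (add_zero 0),
        mul_assoc, ← (hw.commute_sum _).eq, hw.mul_sum]
  calc E.character a = κ * F.lam (a * ∑ r, w r) := by
        rw [character, LinearMap.comp_apply, AlgHom.toLinearMap_apply, haction, hκ, hproj]; rfl
    _ = F.phi (κ • ∑ r, w r) a := by rw [F.phi_apply, mul_smul_comm, map_smul, smul_eq_mul]

theorem exists_dualForm_eq (hw : E.IsAdapted w) (F : FrobeniusStar 𝒜) :
    ∃ (e : A) (c : ℂ), E.IsCentralIdempotent e ∧ F.phi.symm E.character = c • e ∧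
      F.dualForm 1 E.twistedCharacter E.twistedCharacter
        = ((‖c‖ ^ 2 : ℝ) : ℂ) * F.form e e / (m : ℂ) := by
  have := F.isSemisimpleRing
  have hm : (m : ℂ) ≠ 0 := Nat.cast_ne_zero.2 (NeZero.ne m)
  obtain ⟨κ, -, hκ⟩ := hw.exists_phi_symm_character F
  refine ⟨(m : ℂ)⁻¹ • ∑ r, w r, κ * m, hw.isCentralIdempotent, ?_, ?_⟩
  · rw [hκ, smul_smul, mul_assoc, mul_inv_cancel₀ hm, mul_one]
  · rw [hw.dualForm_twistedCharacter_self hκ, F.form_smul_smul,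
      F.form_sum_of_isGradedUnitaryRep hw.1, norm_mul, Complex.norm_natCast, Complex.star_def,
      Complex.mul_conj', map_inv₀, Complex.conj_natCast]
    push_cast
    field_simp

theorem dualForm_eq_zero {N : Type*} [AddCommGroup N] [Module ℂ N] [Module (𝒜 0) N]
    [IsSimpleModule (𝒜 0) N] [IsScalarTower ℂ (𝒜 0) N] {E' : Extension 𝒜 N} {w' : ZMod m → A}
    (hw : E.IsAdapted w) (hw' : E'.IsAdapted w') (F : FrobeniusStar 𝒜)
    (h : ¬ Nonempty (M ≃ₗ[𝒜 0] N)) :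
    F.dualForm 1 E.twistedCharacter E'.twistedCharacter = 0 := by
  obtain ⟨κ, -, hκ⟩ := hw.exists_phi_symm_character F
  obtain ⟨κ', -, hκ'⟩ := hw'.exists_phi_symm_character F
  have hblocks : w 0 * w' 0 = 0 :=
    congrArg Subtype.val (hw.isBlockIdempotent.mul_eq_zero hw'.isBlockIdempotent h)
  have hmul : w (-1) * w' 1 = 0 := by
    rw [← hw.mul_zero, ← hw'.zero_mul, mul_assoc, ← mul_assoc (w 0), hblocks, zero_mul, mul_zero]
  rw [FrobeniusStar.dualForm, hw.phi_symm_twistedCharacter hκ, hw'.phi_symm_twistedCharacter hκ',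
    F.form_smul_smul, FrobeniusStar.form, hw'.star_eq, neg_neg, hmul, map_zero, mul_zero]

theorem dualForm_self_ne_zero (hw : E.IsAdapted w) (F : FrobeniusStar 𝒜) :
    F.dualForm 1 E.twistedCharacter E.twistedCharacter ≠ 0 := by
  obtain ⟨κ, hκ0, hκ⟩ := hw.exists_phi_symm_character F
  have : Nontrivial M := IsSimpleModule.nontrivial (𝒜 0) M
  have hw0 : w 0 ≠ 0 := fun h => hw.isBlockIdempotent.ne_zero (Subtype.ext h)
  have hlam : F.lam (w 0) ≠ 0 := by
    simpa only [hw.star_eq, hw.mul, neg_zero, add_zero] using F.lam_mul_star_ne_zero hw0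
  rw [hw.dualForm_twistedCharacter_self hκ]
  exact mul_ne_zero (mul_ne_zero hκ0 (star_ne_zero.2 hκ0)) hlam

end IsAdapted

end Extension

end TwistedCharacter

/-! ### Invariant simple modules -/

section Induced

variable {m : ℕ} {A : Type u} [Ring A] [Algebra ℂ A] {𝒜 : ZMod m → Submodule ℂ A}
  [GradedAlgebra 𝒜] {M : Type v} [AddCommGroup M] [Module ℂ M] [Module (𝒜 0) M] {r s : ZMod m}

theorem smul_mem_tensorGrade_add {a : A} (ha : a ∈ 𝒜 r) {t : TensorInd 𝒜 M}
    (ht : t ∈ tensorGrade 𝒜 M s) : a • t ∈ tensorGrade 𝒜 M (r + s) := by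
  induction ht using Submodule.span_induction with
  | mem t ht =>
    obtain ⟨b, hb, x, rfl⟩ := ht
    exact Submodule.subset_span ⟨a * b, SetLike.mul_mem_graded ha hb, x, rfl⟩
  | zero => rw [smul_zero]; exact zero_mem _
  | add s t _ _ hs ht => rw [smul_add]; exact add_mem hs ht
  | smul c t _ ht => rw [smul_comm]; exact Submodule.smul_mem _ c ht

variable (𝒜 M) in
/-- The class of `a ⊗ x` in the induced module. -/
def ind : A →ₗ[ℂ] M →ₗ[ℂ] Induced 𝒜 M :=
  (TensorProduct.mk ℂ A M).compr₂
    (((nullSocle 𝒜 M).mkQ ∘ₗ (balancedRel 𝒜 M).mkQ).restrictScalars ℂ)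

theorem smul_ind (a b : A) (x : M) : a • ind 𝒜 M b x = ind 𝒜 M (a * b) x := rfl

theorem ind_mul_coe (a : A) (b : 𝒜 0) (x : M) : ind 𝒜 M (a * b) x = ind 𝒜 M a (b • x) :=
  congrArg (nullSocle 𝒜 M).mkQ <|
    (Submodule.Quotient.eq _).2 (Submodule.subset_span ⟨a, b, x, rfl⟩)

theorem conjugate_eq_map₂ (r : ZMod m) :
    conjugate 𝒜 M r = Submodule.map₂ (ind 𝒜 M) (𝒜 r) ⊤ := by
  rw [conjugate, tensorGrade, Submodule.map_span, Submodule.map₂_eq_span_image2]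
  congr 1
  ext t
  constructor
  · rintro ⟨_, ⟨a, ha, x, rfl⟩, rfl⟩
    exact ⟨a, ha, x, trivial, rfl⟩
  · rintro ⟨a, ha, x, -, rfl⟩
    exact ⟨_, ⟨a, ha, x, rfl⟩, rfl⟩

theorem ind_mem_conjugate {a : A} (ha : a ∈ 𝒜 r) (x : M) : ind 𝒜 M a x ∈ conjugate 𝒜 M r :=
  conjugate_eq_map₂ (𝒜 := 𝒜) (M := M) r ▸ Submodule.apply_mem_map₂ _ ha Submodule.mem_top

theorem IsGradedUnitaryRep.conjugate_le_range_ind [StarRing A] {w : ZMod m → A}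
    (hw : IsGradedUnitaryRep 𝒜 w)
    (hone : ∀ x : M, (⟨w 0, hw.mem 0⟩ : 𝒜 0) • x = x) (r : ZMod m) :
    conjugate 𝒜 M r ≤ LinearMap.range (ind 𝒜 M (w r)) := by
  rw [conjugate_eq_map₂, Submodule.map₂_le]
  intro a ha x _
  refine ⟨(⟨a * w (-r), hw.mul_neg_mem_zero ha⟩ : 𝒜 0) • x, ?_⟩
  calc ind 𝒜 M (w r) ((⟨a * w (-r), hw.mul_neg_mem_zero ha⟩ : 𝒜 0) • x)
      = ind 𝒜 M (a * w (-r) * w r) x := by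
        rw [← ind_mul_coe, (hw.commute_zero _ (hw.mul_neg_mem_zero ha) r).eq]
    _ = ind 𝒜 M (a * (⟨w 0, hw.mem 0⟩ : 𝒜 0)) x := by rw [hw.mul_neg_mul]
    _ = ind 𝒜 M a x := by rw [ind_mul_coe, hone]

variable [IsScalarTower ℂ (𝒜 0) M]

/-- The map `a ⊗ x ↦ a g(x)`, by which the `𝒜 0`-linear maps `g : M → 𝒜 0` separate points of the
induced module. -/
def tensorEval (g : M →ₗ[𝒜 0] 𝒜 0) : TensorInd 𝒜 M →ₗ[A] A :=
  (balancedRel 𝒜 M).liftQ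
    (TensorProduct.AlgebraTensorModule.lift <|
      LinearMap.toSpanSingleton A (M →ₗ[ℂ] A) ((𝒜 0).subtype ∘ₗ g.restrictScalars ℂ))
    (Submodule.span_le.2 <| by
      rintro _ ⟨a, b, x, rfl⟩
      simp [mul_assoc])

theorem tensorEval_mem (g : M →ₗ[𝒜 0] 𝒜 0) {t : TensorInd 𝒜 M}
    (ht : t ∈ tensorGrade 𝒜 M r) : tensorEval g t ∈ 𝒜 r := by
  suffices h : tensorGrade 𝒜 M r ≤ (𝒜 r).comap ((tensorEval g).restrictScalars ℂ) from h ht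
  refine Submodule.span_le.2 ?_
  rintro _ ⟨a, ha, x, rfl⟩
  exact mul_zero_mem (g x) ha

namespace FrobeniusStar

variable [StarRing A] [StarModule ℂ A] (F : FrobeniusStar 𝒜)

include F in
theorem nullSocle_le_ker_tensorEval (g : M →ₗ[𝒜 0] 𝒜 0) :
    nullSocle 𝒜 M ≤ LinearMap.ker (tensorEval g) := by
  refine sSup_le ?_
  rintro U ⟨hU, hU0⟩ t ht
  have ht' : t ∈ U.restrictScalars ℂ := ht
  rw [hU] at ht'
  refine Submodule.iSup_induction _ (motive := fun t => tensorEval g t = 0) ht' ?_ (map_zero _)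
    fun s t hs ht => by rw [map_add, hs, ht, add_zero]
  rintro r t ⟨htU, htr⟩
  have hstar : star (tensorEval g t) ∈ 𝒜 (-r) := F.star_mem r _ (tensorEval_mem g htr)
  have hzero : star (tensorEval g t) • t ∈ U.restrictScalars ℂ ⊓ tensorGrade 𝒜 M 0 :=
    ⟨U.smul_mem _ htU, by simpa using smul_mem_tensorGrade_add hstar htr⟩
  rw [hU0, Submodule.mem_bot] at hzero
  refine F.eq_zero_of_star_mul ?_
  rw [← smul_eq_mul, ← map_smul, hzero, map_zero]

include F in
theorem mul_eq_zero_of_ind_eq_zero {f : 𝒜 0} (hf : IsBlockIdempotent M f) {a : A}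
    (ha : ind 𝒜 M a = 0) : a * f = 0 := by
  refine map_eq_zero_of_mem_isotypicComponent
    ((AddMonoidHom.mulLeft a).comp (𝒜 0).subtype.toAddMonoidHom) (fun g x => ?_) hf.mem
  exact F.nullSocle_le_ker_tensorEval g
    ((Submodule.Quotient.mk_eq_zero _).1 (LinearMap.congr_fun ha x))

end FrobeniusStar

end Induced

section Invariant

variable {m : ℕ} {A : Type u} [Ring A] [Algebra ℂ A] {𝒜 : ZMod m → Submodule ℂ A}
  [GradedAlgebra 𝒜] {M : Type v} [AddCommGroup M] [Module ℂ M] [Module (𝒜 0) M]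
  [IsScalarTower ℂ (𝒜 0) M] {r : ZMod m}

/-- `Φ` is a homomorphism of `𝒜 0`-bimodules from `𝒜 r` to the endomorphisms of the vector
space `M`, on which `𝒜 0` acts from both sides through its action on `M`. -/
structure IsBimoduleHom (Φ : 𝒜 r →ₗ[ℂ] Module.End ℂ M) : Prop where
  map_zero_mul : ∀ (b : 𝒜 0) (a : 𝒜 r),
    Φ ⟨b * a, zero_mul_mem b a.2⟩ = Algebra.lsmul ℂ ℂ M b * Φ a
  map_mul_zero : ∀ (b : 𝒜 0) (a : 𝒜 r),
    Φ ⟨a * b, mul_zero_mem b a.2⟩ = Φ a * Algebra.lsmul ℂ ℂ M b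

theorem exists_isBimoduleHom_of_conjugate_equiv [Nontrivial M] (e : conjugate 𝒜 M r ≃ₗ[ℂ] M)
    (he : ∀ (a : 𝒜 0) (t : conjugate 𝒜 M r),
      e ⟨(a : A) • (t : Induced 𝒜 M), smul_mem_conjugate a t.2⟩ = a • e t) :
    ∃ Φ : 𝒜 r →ₗ[ℂ] Module.End ℂ M, IsBimoduleHom Φ ∧ Φ ≠ 0 ∧
      ∀ a, Φ a = 0 → ind 𝒜 M a = 0 := by
  let Φ : 𝒜 r →ₗ[ℂ] Module.End ℂ M :=
    LinearMap.mk₂ ℂ (fun a x => e ⟨ind 𝒜 M a x, ind_mem_conjugate a.2 x⟩)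
      (fun a b x => by
        rw [← map_add]; exact congrArg e (Subtype.ext ((ind 𝒜 M).map_add₂ _ _ _)))
      (fun c a x => by
        rw [← map_smul]; exact congrArg e (Subtype.ext ((ind 𝒜 M).map_smul₂ _ _ _)))
      (fun a x y => by rw [← map_add]; exact congrArg e (Subtype.ext (map_add _ _ _)))
      (fun c a x => by rw [← map_smul]; exact congrArg e (Subtype.ext (map_smul _ _ _)))
  have hker (a : 𝒜 r) (ha : Φ a = 0) : ind 𝒜 M a = 0 := LinearMap.ext fun x =>
    congrArg Subtype.val (e.map_eq_zero_iff.1 (LinearMap.congr_fun ha x))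
  refine ⟨Φ, ⟨fun b a => LinearMap.ext fun x => he b ⟨_, ind_mem_conjugate a.2 x⟩,
    fun b a => LinearMap.ext fun x => congrArg e (Subtype.ext (ind_mul_coe _ b x))⟩, ?_, hker⟩
  intro hΦ
  have hbot : conjugate 𝒜 M r = ⊥ := by
    rw [conjugate_eq_map₂, eq_bot_iff, Submodule.map₂_le]
    intro a ha x _
    rw [Submodule.mem_bot, hker ⟨a, ha⟩ (LinearMap.congr_fun hΦ _), LinearMap.zero_apply]
  obtain ⟨x, hx⟩ := exists_ne (0 : M)
  have : e.symm x = 0 := Subtype.ext ((Submodule.mem_bot ℂ).1 (hbot ▸ (e.symm x).2))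
  exact hx (e.symm.map_eq_zero_iff.1 this)

namespace IsBimoduleHom

variable {Φ : 𝒜 r →ₗ[ℂ] Module.End ℂ M} [IsSimpleModule (𝒜 0) M] [FiniteDimensional ℂ M]

theorem exists_eq_one (hΦ : IsBimoduleHom Φ) (h0 : Φ ≠ 0) : ∃ u, Φ u = 1 := by
  have hleft (X : Module.End ℂ M) (a : 𝒜 r) : ∃ b, Φ b = X * Φ a := by
    obtain ⟨c, rfl⟩ := lsmul_surjective ℂ (𝒜 0) M X
    exact ⟨_, hΦ.map_zero_mul c a⟩
  have hright (X : Module.End ℂ M) (a : 𝒜 r) : ∃ b, Φ b = Φ a * X := by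
    obtain ⟨c, rfl⟩ := lsmul_surjective ℂ (𝒜 0) M X
    exact ⟨_, hΦ.map_mul_zero c a⟩
  let I : Ideal (Module.End ℂ M) :=
    { LinearMap.range Φ with
      smul_mem' := by
        rintro X _ ⟨a, rfl⟩
        exact hleft X a }
  have : I.IsTwoSided := ⟨by
    rintro _ X ⟨a, rfl⟩
    exact hright X a⟩
  refine one_mem_of_isTwoSided_of_ne_bot (I := I) fun hI => h0 (LinearMap.ext fun a => ?_)
  have ha : Φ a ∈ I := ⟨a, rfl⟩
  rwa [hI, Submodule.mem_bot] at ha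

theorem exists_commute (hΦ : IsBimoduleHom Φ) (h0 : Φ ≠ 0) {f : 𝒜 0}
    (hf : IsBlockIdempotent M f) (hker : ∀ a, Φ a = 0 → (a : A) * f = 0) :
    ∃ v ∈ 𝒜 r, v ≠ 0 ∧ (∀ a ∈ 𝒜 0, Commute a v) ∧ v * f = v := by
  obtain ⟨u, hu⟩ := hΦ.exists_eq_one h0
  have hff : (f : A) * f = f := congrArg Subtype.val hf.mul_self
  have hone : Algebra.lsmul ℂ ℂ M f = 1 := LinearMap.ext hf.smul_eq
  have hnontrivial : Nontrivial M := IsSimpleModule.nontrivial (𝒜 0) M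
  have hΦuf : Φ ⟨u * f, mul_zero_mem f u.2⟩ = 1 := by rw [hΦ.map_mul_zero, hu, one_mul, hone]
  refine ⟨u * f, mul_zero_mem f u.2, fun h => ?_, fun a ha => ?_, by rw [mul_assoc, hff]⟩
  · have hzero : (⟨u * f, mul_zero_mem f u.2⟩ : 𝒜 r) = 0 := Subtype.ext h
    rw [hzero, map_zero] at hΦuf
    exact zero_ne_one hΦuf
  · have hcomm : (a * u - u * a) * (f : A) = 0 :=
      hker (⟨a * u, zero_mul_mem ⟨a, ha⟩ u.2⟩ - ⟨u * a, mul_zero_mem ⟨a, ha⟩ u.2⟩) <| by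
        rw [map_sub, hΦ.map_zero_mul ⟨a, ha⟩, hΦ.map_mul_zero ⟨a, ha⟩, hu, one_mul, mul_one,
          sub_self]
    have hfa : f * a = a * f := congrArg Subtype.val (hf.commute ⟨a, ha⟩).eq
    rw [sub_mul, sub_eq_zero, mul_assoc, mul_assoc, ← hfa, ← mul_assoc (u : A)] at hcomm
    exact hcomm

end IsBimoduleHom

theorem IsGradedUnitaryRep.exists_mul_eq_smul [StarRing A] [IsSimpleModule (𝒜 0) M]
    [FiniteDimensional ℂ M] {w : ZMod m → A} (hw : IsGradedUnitaryRep 𝒜 w)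
    (hblock : IsBlockIdempotent M (⟨w 0, hw.mem 0⟩ : 𝒜 0))
    {z : A} (hz : z ∈ 𝒜 r) (hcomm : ∀ a ∈ 𝒜 0, Commute a z) :
    ∃ c : ℂ, z * w 0 = c • w r := by
  have hb (a : 𝒜 0) : Commute a ⟨z * w (-r), hw.mul_neg_mem_zero hz⟩ :=
    Subtype.ext ((hcomm a a.2).mul_right (hw.commute_zero a a.2 (-r))).eq
  obtain ⟨c, hc⟩ := hblock.exists_mul_eq_smul ℂ hb
  have hc' : z * w (-r) * w 0 = c • w 0 := congrArg Subtype.val hc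
  refine ⟨c, ?_⟩
  rw [← hw.mul_neg_mul z r, ← hw.zero_mul r, ← mul_assoc, hc', smul_mul_assoc, hw.zero_mul]

variable [IsSimpleModule (𝒜 0) M] [StarRing A] [StarModule ℂ A] (F : FrobeniusStar 𝒜)

include F in
theorem FrobeniusStar.exists_isGradedUnitaryRep_of_isInvariant [NeZero m] [FiniteDimensional ℂ A]
    (hM : IsInvariant 𝒜 M) :
    ∃ (w : ZMod m → A) (hw : IsGradedUnitaryRep 𝒜 w),
      IsBlockIdempotent M (⟨w 0, hw.mem 0⟩ : 𝒜 0) := by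
  have := F.isSemisimpleRing_zero
  have : Nontrivial M := IsSimpleModule.nontrivial (𝒜 0) M
  have : FiniteDimensional ℂ M := Module.Finite.trans (𝒜 0) M
  obtain ⟨f, hf⟩ := exists_isBlockIdempotent (𝒜 0) M
  obtain ⟨e, he⟩ := hM 1
  obtain ⟨Φ, hΦ, hΦ0, hker⟩ := exists_isBimoduleHom_of_conjugate_equiv e he
  obtain ⟨v, hv, hv0, hcomm, hvf⟩ := hΦ.exists_commute hΦ0 hf fun a ha =>
    F.mul_eq_zero_of_ind_eq_zero hf (hker a ha)
  obtain ⟨w, hw, hwf⟩ := F.exists_isGradedUnitaryRep hf hv hv0 hcomm hvf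
  exact ⟨w, hw, by simpa only [hwf] using hf⟩

namespace IsGradedUnitaryRep

variable {w : ZMod m → A}

include F in
theorem ind_injective (hw : IsGradedUnitaryRep 𝒜 w)
    (hblock : IsBlockIdempotent M (⟨w 0, hw.mem 0⟩ : 𝒜 0)) (r : ZMod m) :
    Function.Injective (ind 𝒜 M (w r)) := by
  have : Nontrivial M := IsSimpleModule.nontrivial (𝒜 0) M
  refine (injective_iff_map_eq_zero _).2 fun x hx => by_contra fun hx0 => ?_
  have hind : ind 𝒜 M (w r) = 0 := LinearMap.ext fun y => by
    obtain ⟨b, rfl⟩ := IsSimpleModule.toSpanSingleton_surjective (𝒜 0) hx0 y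
    rw [LinearMap.toSpanSingleton_apply, ← ind_mul_coe, ← (hw.commute_zero _ b.2 r).eq, ← smul_ind,
      hx, smul_zero, LinearMap.zero_apply]
  have hwr : w r = 0 := by
    simpa only [hw.mul_zero] using F.mul_eq_zero_of_ind_eq_zero hblock hind
  have hw0 : w 0 = 0 := by rw [← add_neg_cancel r, ← hw.mul, hwr, zero_mul]
  exact hblock.ne_zero (Subtype.ext hw0)

include F in
theorem isInvariant (hw : IsGradedUnitaryRep 𝒜 w)
    (hblock : IsBlockIdempotent M (⟨w 0, hw.mem 0⟩ : 𝒜 0)) : IsInvariant 𝒜 M := by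
  intro r
  have hrange : LinearMap.range (ind 𝒜 M (w r)) = conjugate 𝒜 M r := by
    refine le_antisymm ?_ (hw.conjugate_le_range_ind hblock.smul_eq r)
    rintro _ ⟨x, rfl⟩
    exact ind_mem_conjugate (hw.mem r) x
  let e : M ≃ₗ[ℂ] conjugate 𝒜 M r :=
    LinearEquiv.ofInjective _ (hw.ind_injective F hblock r) ≪≫ₗ LinearEquiv.ofEq _ _ hrange
  have he (x : M) : (e x : Induced 𝒜 M) = ind 𝒜 M (w r) x := rfl
  refine ⟨e.symm, fun a t => e.symm_apply_eq.2 (Subtype.ext ?_)⟩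
  rw [he, ← ind_mul_coe, ← (hw.commute_zero _ a.2 r).eq, ← smul_ind, ← he, e.apply_symm_apply]

end IsGradedUnitaryRep

end Invariant

section Main

variable {m : ℕ} [NeZero m] {A : Type u} [Ring A] [Algebra ℂ A] [FiniteDimensional ℂ A]
  [StarRing A] [StarModule ℂ A] {𝒜 : ZMod m → Submodule ℂ A} [GradedAlgebra 𝒜]
  (F : FrobeniusStar 𝒜) {M : Type v} [AddCommGroup M] [Module ℂ M] [Module (𝒜 0) M]
  [IsScalarTower ℂ (𝒜 0) M] [IsSimpleModule (𝒜 0) M]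

include F in
theorem nonempty_extension (hM : IsInvariant 𝒜 M) : Nonempty (Extension 𝒜 M) :=
  have ⟨_, hw, hblock⟩ := F.exists_isGradedUnitaryRep_of_isInvariant hM
  hw.nonempty_extension hblock.smul_eq

namespace Extension

include F in
theorem exists_isAdapted_of_isInvariant (E : Extension 𝒜 M) (hM : IsInvariant 𝒜 M) :
    ∃ w, E.IsAdapted w :=
  have : FiniteDimensional ℂ M := Module.Finite.trans (𝒜 0) M
  have ⟨_, hw, hblock⟩ := F.exists_isGradedUnitaryRep_of_isInvariant hM
  E.exists_isAdapted hw hblock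

theorem exists_dualForm_eq (E : Extension 𝒜 M) (hM : IsInvariant 𝒜 M) :
    ∃ (e : A) (c : ℂ), E.IsCentralIdempotent e ∧ F.phi.symm E.character = c • e ∧
      F.dualForm 1 E.twistedCharacter E.twistedCharacter
        = ((‖c‖ ^ 2 : ℝ) : ℂ) * F.form e e / (m : ℂ) :=
  have ⟨_, hw⟩ := E.exists_isAdapted_of_isInvariant F hM
  hw.exists_dualForm_eq F

theorem dualForm_eq_zero {N : Type*} [AddCommGroup N] [Module ℂ N] [Module (𝒜 0) N]
    [IsScalarTower ℂ (𝒜 0) N] [IsSimpleModule (𝒜 0) N] (E : Extension 𝒜 M) (E' : Extension 𝒜 N)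
    (hM : IsInvariant 𝒜 M) (hN : IsInvariant 𝒜 N) (h : ¬ Nonempty (M ≃ₗ[𝒜 0] N)) :
    F.dualForm 1 E.twistedCharacter E'.twistedCharacter = 0 :=
  have ⟨_, hw⟩ := E.exists_isAdapted_of_isInvariant F hM
  have ⟨_, hw'⟩ := E'.exists_isAdapted_of_isInvariant F hN
  hw.dualForm_eq_zero hw' F h

end Extension

include F in
theorem FrobeniusStar.isInvariant_of_mul_ne_zero {f : 𝒜 0} (hf : IsBlockIdempotent M f) {z : A}
    (hz : z ∈ 𝒜 (-1)) (hcomm : ∀ a ∈ 𝒜 0, Commute a z) (hzf : z * f ≠ 0) : IsInvariant 𝒜 M := by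
  have : FiniteDimensional ℂ M := Module.Finite.trans (𝒜 0) M
  have hff : (f : A) * f = f := congrArg Subtype.val hf.mul_self
  have hstar_f : star (f : A) = f := F.star_coe_of_isBlockIdempotent hf
  have hf_comm (a : A) (ha : a ∈ 𝒜 0) : Commute a (f : A) :=
    congrArg Subtype.val (hf.commute ⟨a, ha⟩).symm
  have hv_eq : star (z * f) = star z * f := by
    rw [star_mul, hstar_f]
    simpa only [star_star, hstar_f] using (hcomm _ f.2).star_star.eq
  have hv : star z * f ∈ 𝒜 1 := mul_zero_mem f (by simpa using F.star_mem _ z hz)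
  have hv_comm : ∀ a ∈ 𝒜 0, Commute a (star z * f) := fun a ha =>
    (star_star a ▸ (hcomm _ (F.star_mem_zero ha)).star_star).mul_right (hf_comm a ha)
  obtain ⟨w, hw, hwf⟩ := F.exists_isGradedUnitaryRep hf hv
    (hv_eq ▸ star_ne_zero.2 hzf) hv_comm (by rw [mul_assoc, hff])
  exact hw.isInvariant F (by simpa only [hwf] using hf)

theorem Extension.exists_phi_symm_twistedCharacter_smul_eq (E : Extension 𝒜 M)
    (hM : IsInvariant 𝒜 M) {f : 𝒜 0} (hf : IsBlockIdempotent M f) {z : A} (hz : z ∈ 𝒜 (-1))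
    (hcomm : ∀ a ∈ 𝒜 0, Commute a z) :
    ∃ c : ℂ, F.phi.symm (extendByZero 𝒜 1 (c • E.twistedCharacter)) = z * f := by
  have : FiniteDimensional ℂ M := Module.Finite.trans (𝒜 0) M
  obtain ⟨w, hw⟩ := E.exists_isAdapted_of_isInvariant F hM
  obtain ⟨κ, hκ0, hκ⟩ := hw.exists_phi_symm_character F
  obtain ⟨c, hc⟩ := hw.exists_mul_eq_smul hw.isBlockIdempotent hz hcomm
  refine ⟨c * κ⁻¹, ?_⟩
  rw [extendByZero, LinearMap.smul_comp, map_smul, ← extendByZero, hw.phi_symm_twistedCharacter hκ,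
    smul_smul, inv_mul_cancel_right₀ hκ0, ← hc, hf.unique hw.isBlockIdempotent]

section Representatives

variable {ι : Type w} {M : ι → Type v} [∀ i, AddCommGroup (M i)] [∀ i, Module ℂ (M i)]
  [∀ i, Module (𝒜 0) (M i)] [∀ i, IsScalarTower ℂ (𝒜 0) (M i)] [∀ i, IsSimpleModule (𝒜 0) (M i)]

include F in
theorem linearIndependent_twistedCharacter (hinv : ∀ i, IsInvariant 𝒜 (M i))
    (hrep : ∀ i j, Nonempty (M i ≃ₗ[𝒜 0] M j) → i = j) (E : ∀ i, Extension 𝒜 (M i)) :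
    LinearIndependent ℂ fun i => (E i).twistedCharacter := by
  refine F.linearIndependent_of_dualForm_eq_zero (fun i => ?_) fun i j hij =>
    (E i).dualForm_eq_zero F (E j) (hinv i) (hinv j) (mt (hrep i j) hij)
  obtain ⟨w, hw⟩ := (E i).exists_isAdapted_of_isInvariant F (hinv i)
  exact hw.dualForm_self_ne_zero F

include F in
theorem span_twistedCharacter (hinv : ∀ i, IsInvariant 𝒜 (M i))
    (hall : ∀ (S : Type u) [AddCommGroup S] [Module ℂ S] [Module (𝒜 0) S]
      [IsScalarTower ℂ (𝒜 0) S], IsSimpleModule (𝒜 0) S → IsInvariant 𝒜 S →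
        ∃ i, Nonempty (S ≃ₗ[𝒜 0] M i)) (E : ∀ i, Extension 𝒜 (M i)) :
    Submodule.span ℂ (Set.range fun i => (E i).twistedCharacter)
      = twistedClassFunctionals 𝒜 1 := by
  refine le_antisymm (Submodule.span_le.2 ?_) fun γ hγ => ?_
  · rintro _ ⟨i, rfl⟩
    exact (E i).twistedCharacter_mem
  have := F.isSemisimpleRing_zero
  let L : Module.Dual ℂ (𝒜 1) →ₗ[ℂ] A := F.phi.symm.toLinearMap ∘ₗ (gradeProj 𝒜 1).dualMap
  let N := (Submodule.span ℂ (Set.range fun i => (E i).twistedCharacter)).map L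
  have hL : Function.Injective L := F.phi_symm_extendByZero_injective
  have hLγ : L γ ∈ 𝒜 (-1) := F.phi_symm_extendByZero_mem γ
  have hcomm : ∀ a ∈ 𝒜 0, Commute a (L γ) := fun a => F.commute_phi_symm_extendByZero hγ
  have hblock (g : 𝒜 0) (S : Ideal (𝒜 0)) (hS : IsSimpleModule (𝒜 0) S)
      (hg : IsBlockIdempotent S g) : L γ * g ∈ N := by
    by_cases hzero : L γ * g = 0
    · exact hzero ▸ zero_mem _
    obtain ⟨i, ⟨e⟩⟩ := hall S hS (F.isInvariant_of_mul_ne_zero hg hLγ hcomm hzero)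
    obtain ⟨c, hc⟩ := (E i).exists_phi_symm_twistedCharacter_smul_eq F (hinv i) (hg.congr e) hLγ
      hcomm
    exact ⟨_, Submodule.smul_mem _ c (Submodule.subset_span ⟨i, rfl⟩), hc⟩
  have hclosure : AddSubmonoid.closure
      {g | ∃ S : Ideal (𝒜 0), IsSimpleModule (𝒜 0) S ∧ IsBlockIdempotent S g} ≤
      N.toAddSubmonoid.comap ((AddMonoidHom.mulLeft (L γ)).comp (𝒜 0).subtype.toAddMonoidHom) :=
    AddSubmonoid.closure_le.2 fun g ⟨S, hS, hg⟩ => hblock g S hS hg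
  have hmem : L γ * (1 : 𝒜 0) ∈ N := hclosure (one_mem_closure_blockIdempotents (𝒜 0))
  rw [SetLike.GradeZero.coe_one, mul_one] at hmem
  obtain ⟨δ, hδ, h⟩ := hmem
  exact hL h ▸ hδ

end Representatives

end Main

end

end TwistedFrobenius

open TwistedFrobenius in
theorem theorem4p11 {m : ℕ} [NeZero m] {A : Type u} [Ring A] [Algebra ℂ A]
    [FiniteDimensional ℂ A] [StarRing A] [StarModule ℂ A]
    (𝒜 : ZMod m → Submodule ℂ A) [GradedAlgebra 𝒜] (F : FrobeniusStar 𝒜) :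
    -- every invariant simple module extends to `A`, so that twisted characters exist
    (∀ (M : Type v) [AddCommGroup M] [Module ℂ M] [Module (𝒜 0) M] [IsScalarTower ℂ (𝒜 0) M],
      IsSimpleModule (𝒜 0) M → IsInvariant 𝒜 M → Nonempty (Extension 𝒜 M)) ∧
    -- the norm formula, where `e` and `c` are determined by the first two conditions
    (∀ (M : Type v) [AddCommGroup M] [Module ℂ M] [Module (𝒜 0) M] [IsScalarTower ℂ (𝒜 0) M],
      IsSimpleModule (𝒜 0) M → IsInvariant 𝒜 M → ∀ E : Extension 𝒜 M,
        ∃ (e : A) (c : ℂ), E.IsCentralIdempotent e ∧ F.phi.symm E.character = c • e ∧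
          F.dualForm 1 E.twistedCharacter E.twistedCharacter
            = ((‖c‖ ^ 2 : ℝ) : ℂ) * F.form e e / (m : ℂ)) ∧
    -- orthogonality
    (∀ (M N : Type v) [AddCommGroup M] [Module ℂ M] [Module (𝒜 0) M] [IsScalarTower ℂ (𝒜 0) M]
      [AddCommGroup N] [Module ℂ N] [Module (𝒜 0) N] [IsScalarTower ℂ (𝒜 0) N],
      IsSimpleModule (𝒜 0) M → IsInvariant 𝒜 M → IsSimpleModule (𝒜 0) N → IsInvariant 𝒜 N →
        ¬ Nonempty (M ≃ₗ[𝒜 0] N) → ∀ (E : Extension 𝒜 M) (E' : Extension 𝒜 N),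
          F.dualForm 1 E.twistedCharacter E'.twistedCharacter = 0) ∧
    -- for every system `M` of representatives of the isomorphism classes of invariant simple
    -- modules, and every choice of extensions, the twisted characters form an orthogonal basis
    (∀ (ι : Type w) (M : ι → Type v) [∀ i, AddCommGroup (M i)] [∀ i, Module ℂ (M i)]
      [∀ i, Module (𝒜 0) (M i)] [∀ i, IsScalarTower ℂ (𝒜 0) (M i)],
      (∀ i, IsSimpleModule (𝒜 0) (M i)) → (∀ i, IsInvariant 𝒜 (M i)) →
      (∀ i j, Nonempty (M i ≃ₗ[𝒜 0] M j) → i = j) →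
      (∀ (S : Type u) [AddCommGroup S] [Module ℂ S] [Module (𝒜 0) S] [IsScalarTower ℂ (𝒜 0) S],
        IsSimpleModule (𝒜 0) S → IsInvariant 𝒜 S → ∃ i, Nonempty (S ≃ₗ[𝒜 0] M i)) →
      ∀ E : ∀ i, Extension 𝒜 (M i),
        (∀ i j, i ≠ j →
          F.dualForm 1 (E i).twistedCharacter (E j).twistedCharacter = 0) ∧
        LinearIndependent ℂ (fun i => (E i).twistedCharacter) ∧
        Submodule.span ℂ (Set.range fun i => (E i).twistedCharacter)
          = twistedClassFunctionals 𝒜 1) := by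
  refine ⟨?_, ?_, ?_, ?_⟩
  · intro M _ _ _ _ _ hM
    exact nonempty_extension F hM
  · intro M _ _ _ _ _ hM E
    exact E.exists_dualForm_eq F hM
  · intro M N _ _ _ _ _ _ _ _ _ hM _ hN h E E'
    exact E.dualForm_eq_zero F E' hM hN h
  · intro ι M _ _ _ _ _ hinv hrep hall E
    exact ⟨fun i j hij => (E i).dualForm_eq_zero F (E j) (hinv i) (hinv j) (mt (hrep i j) hij),
      linearIndependent_twistedCharacter F hinv hrep E, span_twistedCharacter F hinv hall E⟩
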